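/- Let $f:\mathbb R^n\to\mathbb R$, $G:\mathbb R^n\to\mathbb S^m$ ($\mathbb S^m$: real symmetric $m\times m$ matrices) and $h:\mathbb R^n\to\mathbb R^s$ be twice continuously differentiable, and consider the problem of minimizing $f(x)$ subject to $G(x)\succeq 0$, $h(x)=0$. **Notation.** $X\bullet Y=\operatorname{tr}(XY)$; $\mathcal L_X(Y)=XY+YX$; $\mathcal G_i(x)=\partial G(x)/\partial x_i$; $\Delta G(x;d)=\sum_i d_i\mathcal G_i(x)$; $\mathcal JG(x)^*Y=(\mathcal G_i(x)\bullet Y)_{i=1}^n$; $\nabla h(x)\in\mathbb R^{n\times s}$ has the gradients $\nabla h_j(x)$ as columns; $L(x,Y,z)=f(x)-G(x)\bullet Y+h(x)^\top z$, so $\nabla_xL(x,Y,z)=\nabla f(x)-\mathcal JG(x)^*Y+\nabla h(x)z$. $\Omega(x,Y)\in\mathbb R^{n\times n}$ has entries $2\,Y\bullet\big(\mathcal G_i(x)G(x)^\dagger\mathcal G_j(x)\big)$, where $\dagger$ is the Moore–Penrose inverse. $\Lambda(x)$ is the set of $(Y,z)\in\mathbb S^m\times\mathbb R^s$ such that $(x,Y,z)$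 is a KKT triplet: $\nabla_xL(x,Y,z)=0$, $h(x)=0$, $G(x)\succeq0$, $Y\succeq0$, $G(x)\bullet Y=0$. For $\mu>0$, $(x,Y,z)$ is a BKKT triplet with barrier parameter $\mu$ if $\nabla_xL(x,Y,z)=0$, $h(x)=0$, $G(x)\succ0$, $Y\succ0$, $G(x)Y=\mu I$; then $x$ is called a BKKT point. **Assumptions.** Let $x^*$ be a KKT point, and let the columns of $E$ form an (arbitrary) orthonormal basis of the null space of $G(x^*)$. Put $C(x^*)=\{d:\nabla f(x^*)^\top d=0,\ \nabla h(x^*)^\top d=0,\ E^\top\Delta G(x^*;d)E\succeq0\}$. Suppose that 1. (strict complementarity) there is $(Y_*,z_*)\in\Lambda(x^*)$ with $G(x^*)+Y_*\succ0$; 2. (strong second-order sufficient condition) $d^\top\big(\nabla^2_{xx}L(x^*,Y,z)+\Omega(x^*,Y)\big)d>0$ for all $(Y,z)\in\Lambda(x^*)$ and all $d\in C(x^*)\setminus\{0\}$; 3. (MFCQ) $\nabla h(x^*)$ has full column rank and there is $d$ with $G(x^*)+\Delta G(x^*;d)\succ0$ and $\nabla h(x^*)^\top d=0$. Let $(x^k,Y_k,z^k)$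 be BKKT triplets with barrier parameters $\mu_k>0$, where $\mu_k\to0$, $x^k\to x^*$ and $x^k\ne x^*$ for all $k$. **Conclusion.** There is a unique analytic center $(Y_{\rm a},z^{\rm a})$ at $x^*$, i.e. a unique minimizer of $-\log\det(E^\top YE)$ over $(Y,z)\in\Lambda(x^*)$ (with $\log 0=-\infty$). With $w^{\rm a}=(x^*,Y_{\rm a},z^{\rm a})$ and $U$ any matrix whose columns form an orthonormal basis of $\{d:E^\top\Delta G(x^*;d)E=0,\ \nabla h(x^*)^\top d=0\}$, the system $$U^\top\big(\nabla^2_{xx}L(w^{\rm a})\Delta x-\mathcal JG(x^*)^*\Delta Y\big)=0,\quad \mathcal L_{G(x^*)}\Delta Y+\mathcal L_{Y_{\rm a}}\Delta G(x^*;\Delta x)=2I,\quad \nabla h(x^*)^\top\Delta x=0$$ has a solution $(\Delta x,\Delta Y)\in\mathbb R^n\times\mathbb S^m$, and all its solutions have the same $\Delta x$-component, denoted $\xi^*$. Moreover $\xi^*\neq0$ and $$\lim_{k\to\infty}\frac{x^k-x^*}{\|x^k-x^*\|}=\frac{\xi^*}{\|\xi^*\|},\qquad\text{equivalently}\qquad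 \lim_{k\to\infty}\frac{x^*-x^k}{\|x^*-x^k\|}=-\frac{\xi^*}{\|\xi^*\|},$$ i.e. $x^k$ approaches $x^*$ asymptotically along the direction $-\xi^*$. -/

import Mathlib

open scoped Matrix Topology

noncomputable section

/-! ### Linear algebra -/

/-- The columns of `A` form an orthonormal basis of the subspace `S` of `ℝ^a`. -/
def IsOrthonormalBasisMatrix {a b : ℕ} (A : Matrix (Fin a) (Fin b) ℝ)
    (S : Submodule ℝ (EuclideanSpace ℝ (Fin a))) : Prop :=
  Orthonormal ℝ (fun j => WithLp.toLp 2 (A.col j) : Fin b → EuclideanSpace ℝ (Fin a)) ∧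
    Submodule.span ℝ
      (Set.range (fun j => WithLp.toLp 2 (A.col j) : Fin b → EuclideanSpace ℝ (Fin a))) = S

/-- The null space of a square matrix, as a subspace of Euclidean space. -/
def matrixNullSpace {m : ℕ} (A : Matrix (Fin m) (Fin m) ℝ) :
    Submodule ℝ (EuclideanSpace ℝ (Fin m)) :=
  LinearMap.ker (Matrix.toEuclideanLin A)

/-- The four Penrose equations: `B` is the Moore-Penrose inverse of the real matrix `A`. -/
structure IsMoorePenrose {m : ℕ} (A B : Matrix (Fin m) (Fin m) ℝ) : Prop where
  mul_mul_left : A * B * A = A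
  mul_mul_right : B * A * B = B
  symm_left : (A * B)ᵀ = A * B
  symm_right : (B * A)ᵀ = B * A

theorem IsMoorePenrose.unique {m : ℕ} {A B C : Matrix (Fin m) (Fin m) ℝ}
    (hB : IsMoorePenrose A B) (hC : IsMoorePenrose A C) : B = C := by
  have h1 : A * B = A * C := by
    calc A * B = (A * B)ᵀ := hB.symm_left.symm
      _ = ((A * C * A) * B)ᵀ := by rw [hC.mul_mul_left]
      _ = (A * B)ᵀ * (A * C)ᵀ := by rw [← Matrix.transpose_mul]; simp only [Matrix.mul_assoc]
      _ = A * B * (A * C) := by rw [hB.symm_left, hC.symm_left]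
      _ = (A * B * A) * C := by simp only [Matrix.mul_assoc]
      _ = A * C := by rw [hB.mul_mul_left]
  have h2 : B * A = C * A := by
    calc B * A = (B * A)ᵀ := hB.symm_right.symm
      _ = (B * (A * C * A))ᵀ := by rw [hC.mul_mul_left]
      _ = (C * A)ᵀ * (B * A)ᵀ := by rw [← Matrix.transpose_mul]; simp only [Matrix.mul_assoc]
      _ = C * A * (B * A) := by rw [hB.symm_right, hC.symm_right]
      _ = C * (A * B * A) := by simp only [Matrix.mul_assoc]
      _ = C * A := by rw [hB.mul_mul_left]
  calc B = B * A * B := hB.mul_mul_right.symm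
    _ = C * (A * B) := by rw [h2, Matrix.mul_assoc]
    _ = C * A * C := by rw [h1, Matrix.mul_assoc]
    _ = C := hC.mul_mul_right

/-- Every real symmetric matrix has a Moore-Penrose inverse. -/
theorem exists_isMoorePenrose {m : ℕ} {A : Matrix (Fin m) (Fin m) ℝ} (hA : A.IsHermitian) :
    ∃ B, IsMoorePenrose A B := by
  obtain ⟨U, d, hU, hAd⟩ : ∃ (U : Matrix (Fin m) (Fin m) ℝ) (d : Fin m → ℝ),
      Uᵀ * U = 1 ∧ A = U * Matrix.diagonal d * Uᵀ := by
    refine ⟨(hA.eigenvectorUnitary : Matrix (Fin m) (Fin m) ℝ), hA.eigenvalues, ?_, ?_⟩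
    · have := Unitary.coe_star_mul_self hA.eigenvectorUnitary
      rwa [Matrix.star_eq_conjTranspose, Matrix.conjTranspose_eq_transpose_of_trivial] at this
    · have := hA.spectral_theorem
      rw [Unitary.conjStarAlgAut_apply, Matrix.star_eq_conjTranspose,
        Matrix.conjTranspose_eq_transpose_of_trivial] at this
      exact this
  have key : ∀ e e' : Fin m → ℝ, (U * Matrix.diagonal e * Uᵀ) * (U * Matrix.diagonal e' * Uᵀ)
      = U * Matrix.diagonal (fun i => e i * e' i) * Uᵀ := by
    intro e e'
    calc (U * Matrix.diagonal e * Uᵀ) * (U * Matrix.diagonal e' * Uᵀ)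
        = U * Matrix.diagonal e * (Uᵀ * U) * Matrix.diagonal e' * Uᵀ := by
          simp only [Matrix.mul_assoc]
      _ = _ := by rw [hU, Matrix.mul_one, Matrix.mul_assoc U, Matrix.diagonal_mul_diagonal]
  have htr : ∀ e : Fin m → ℝ, (U * Matrix.diagonal e * Uᵀ)ᵀ = U * Matrix.diagonal e * Uᵀ := by
    intro e
    simp [Matrix.transpose_mul, Matrix.mul_assoc]
  refine ⟨U * Matrix.diagonal (fun i => (d i)⁻¹) * Uᵀ, ?_, ?_, ?_, ?_⟩
  · rw [hAd, key, key]; congr; funext i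
    by_cases h : d i = 0 <;> simp [h]
  · rw [hAd, key, key]; congr; funext i
    by_cases h : d i = 0 <;> simp [h]
  · rw [hAd, key, htr]
  · rw [hAd, key, htr]

open Classical in
/-- The Moore-Penrose inverse `A†` (it is applied to symmetric matrices only; see
`pinv_isMoorePenrose` and `IsMoorePenrose.unique`). -/
def pinv {m : ℕ} (A : Matrix (Fin m) (Fin m) ℝ) : Matrix (Fin m) (Fin m) ℝ :=
  if h : ∃ B, IsMoorePenrose A B then h.choose else 0

theorem pinv_isMoorePenrose {m : ℕ} {A : Matrix (Fin m) (Fin m) ℝ} (hA : A.IsHermitian) :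
    IsMoorePenrose A (pinv A) := by
  have h := exists_isMoorePenrose hA
  rw [pinv, dif_pos h]
  exact h.choose_spec

/-- The inner product `X • Y = trace (X Y)` of symmetric matrices. -/
def matInner {m : ℕ} (X Y : Matrix (Fin m) (Fin m) ℝ) : ℝ := (X * Y).trace

/-- The operator `𝓛_X(Y) = X Y + Y X`. -/
def symMul {m : ℕ} (X Y : Matrix (Fin m) (Fin m) ℝ) : Matrix (Fin m) (Fin m) ℝ := X * Y + Y * X

/-! ### Derivatives in coordinates -/

/-- The partial derivative `∂g/∂x_i` at `x`. -/
def partialDeriv {n : ℕ} (g : EuclideanSpace ℝ (Fin n) → ℝ) (i : Fin n)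
    (x : EuclideanSpace ℝ (Fin n)) : ℝ :=
  fderiv ℝ g x (EuclideanSpace.single i 1)

/-- The Hessian matrix `(∂²g/∂x_i∂x_j)` at `x`. -/
def hessianMatrix {n : ℕ} (g : EuclideanSpace ℝ (Fin n) → ℝ) (x : EuclideanSpace ℝ (Fin n)) :
    Matrix (Fin n) (Fin n) ℝ :=
  Matrix.of fun i j => partialDeriv (fun y => partialDeriv g j y) i x

/-! ### Nonlinear semidefinite programs -/

/-- The data of the problem: minimize `f x` subject to `G x ⪰ 0`, `h x = 0`, where
`f : ℝⁿ → ℝ`, `G : ℝⁿ → 𝕊^m` and `h : ℝⁿ → ℝ^s` are twice continuously differentiable. -/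
structure NSDP (n m s : ℕ) where
  f : EuclideanSpace ℝ (Fin n) → ℝ
  G : EuclideanSpace ℝ (Fin n) → Matrix (Fin m) (Fin m) ℝ
  h : EuclideanSpace ℝ (Fin n) → EuclideanSpace ℝ (Fin s)
  G_symm : ∀ x, (G x).IsSymm
  contDiff_f : ContDiff ℝ 2 f
  contDiff_G : ∀ a b, ContDiff ℝ 2 (fun x => G x a b)
  contDiff_h : ContDiff ℝ 2 h

namespace NSDP

variable {n m s : ℕ} (P : NSDP n m s)

/-- `𝒢_i(x) = ∂G(x)/∂x_i`. -/
def partialG (x : EuclideanSpace ℝ (Fin n)) (i : Fin n) : Matrix (Fin m) (Fin m) ℝ :=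
  Matrix.of fun a b => partialDeriv (fun y => P.G y a b) i x

/-- `ΔG(x; d) = ∑ i, d_i 𝒢_i(x)`. -/
def deltaG (x d : EuclideanSpace ℝ (Fin n)) : Matrix (Fin m) (Fin m) ℝ :=
  ∑ i, d i • P.partialG x i

/-- `𝒥G(x)^* Y = (𝒢_1(x) • Y, …, 𝒢_n(x) • Y)`. -/
def adjG (x : EuclideanSpace ℝ (Fin n)) (Y : Matrix (Fin m) (Fin m) ℝ) : Fin n → ℝ :=
  fun i => matInner (P.partialG x i) Y

/-- `∇h(x)`, the `n × s` matrix whose columns are the gradients of the components of `h`. -/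
def gradH (x : EuclideanSpace ℝ (Fin n)) : Matrix (Fin n) (Fin s) ℝ :=
  Matrix.of fun i j => partialDeriv (fun y => P.h y j) i x

/-- `∇f(x)`. -/
def gradF (x : EuclideanSpace ℝ (Fin n)) : Fin n → ℝ := fun i => partialDeriv P.f i x

/-- The Lagrange function `L(x, Y, z) = f(x) - G(x) • Y + h(x)ᵀ z`. -/
def lagrangian (x : EuclideanSpace ℝ (Fin n)) (Y : Matrix (Fin m) (Fin m) ℝ)
    (z : EuclideanSpace ℝ (Fin s)) : ℝ :=
  P.f x - matInner (P.G x) Y + ∑ j, P.h x j * z j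

/-- `∇_x L(x, Y, z) = ∇f(x) - 𝒥G(x)^* Y + ∇h(x) z`. -/
def gradL (x : EuclideanSpace ℝ (Fin n)) (Y : Matrix (Fin m) (Fin m) ℝ)
    (z : EuclideanSpace ℝ (Fin s)) : Fin n → ℝ :=
  P.gradF x - P.adjG x Y + P.gradH x *ᵥ z.ofLp

/-- `∇²_xx L(x, Y, z)`. -/
def hessL (x : EuclideanSpace ℝ (Fin n)) (Y : Matrix (Fin m) (Fin m) ℝ)
    (z : EuclideanSpace ℝ (Fin s)) : Matrix (Fin n) (Fin n) ℝ :=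
  hessianMatrix (fun y => P.lagrangian y Y z) x

/-- The KKT conditions hold for the triplet `(x, Y, z)`. -/
structure IsKKT (x : EuclideanSpace ℝ (Fin n)) (Y : Matrix (Fin m) (Fin m) ℝ)
    (z : EuclideanSpace ℝ (Fin s)) : Prop where
  stationary : P.gradL x Y z = 0
  complementary : matInner (P.G x) Y = 0
  G_posSemidef : (P.G x).PosSemidef
  Y_posSemidef : Y.PosSemidef
  h_eq_zero : P.h x = 0

/-- The set `Λ(x)` of Lagrange multiplier pairs at `x`. -/
def multipliers (x : EuclideanSpace ℝ (Fin n)) :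
    Set (Matrix (Fin m) (Fin m) ℝ × EuclideanSpace ℝ (Fin s)) :=
  {p | P.IsKKT x p.1 p.2}

/-- The barrier KKT conditions hold for the triplet `(x, Y, z)` with barrier parameter `μ > 0`. -/
structure IsBKKT (μ : ℝ) (x : EuclideanSpace ℝ (Fin n)) (Y : Matrix (Fin m) (Fin m) ℝ)
    (z : EuclideanSpace ℝ (Fin s)) : Prop where
  mu_pos : 0 < μ
  stationary : P.gradL x Y z = 0
  G_mul_Y : P.G x * Y = μ • (1 : Matrix (Fin m) (Fin m) ℝ)
  G_posDef : (P.G x).PosDef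
  Y_posDef : Y.PosDef
  h_eq_zero : P.h x = 0

/-- The Mangasarian-Fromovitz constraint qualification at `x`. -/
structure MFCQ (x : EuclideanSpace ℝ (Fin n)) : Prop where
  G_posSemidef : (P.G x).PosSemidef
  h_eq_zero : P.h x = 0
  full_column_rank : LinearIndependent ℝ (P.gradH x).col
  exists_direction : ∃ d : EuclideanSpace ℝ (Fin n),
    (P.G x + P.deltaG x d).PosDef ∧ (P.gradH x)ᵀ *ᵥ d.ofLp = 0

/-- There is a Lagrange multiplier matrix at `x` satisfying strict complementarity. -/
def StrictComplementarity (x : EuclideanSpace ℝ (Fin n)) : Prop :=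
  ∃ Y z, (Y, z) ∈ P.multipliers x ∧ (P.G x + Y).PosDef

/-- The critical cone `C(x)`. Here the columns of `E` form an orthonormal basis of the null space
of `G x`, so that the last two conditions say that `ΔG(x; d)` belongs to the tangent cone of the
positive semidefinite cone at `G x`. -/
def criticalCone {q : ℕ} (E : Matrix (Fin m) (Fin q) ℝ) (x : EuclideanSpace ℝ (Fin n)) :
    Set (EuclideanSpace ℝ (Fin n)) :=
  {d | P.gradF x ⬝ᵥ d.ofLp = 0 ∧ (P.gradH x)ᵀ *ᵥ d.ofLp = 0 ∧
    (P.deltaG x d).IsSymm ∧ (Eᵀ * P.deltaG x d * E).PosSemidef}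

/-- The matrix `Ω(x, Y)` of the sigma term, with entries `2 Y • (𝒢_i(x) G(x)† 𝒢_j(x))`. -/
def sigmaTerm (x : EuclideanSpace ℝ (Fin n)) (Y : Matrix (Fin m) (Fin m) ℝ) :
    Matrix (Fin n) (Fin n) ℝ :=
  Matrix.of fun i j => 2 * matInner Y (P.partialG x i * pinv (P.G x) * P.partialG x j)

/-- The strong second-order sufficient condition at `x` (with `E` as in `criticalCone`). -/
def SSOSC {q : ℕ} (E : Matrix (Fin m) (Fin q) ℝ) (x : EuclideanSpace ℝ (Fin n)) : Prop :=
  ∀ Y z, (Y, z) ∈ P.multipliers x → ∀ d ∈ P.criticalCone E x, d ≠ 0 →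
    0 < d.ofLp ⬝ᵥ ((P.hessL x Y z + P.sigmaTerm x Y) *ᵥ d.ofLp)

/-- The extended-real objective `-log det Y^EE`, where `Y^EE = Eᵀ Y E` and `log 0 = -∞`. -/
def analyticObjective {q : ℕ} (E : Matrix (Fin m) (Fin q) ℝ)
    (Y : Matrix (Fin m) (Fin m) ℝ) : EReal :=
  -ENNReal.log (ENNReal.ofReal (Eᵀ * Y * E).det)

/-- `(Y, z)` is an analytic center at `x`: it minimizes `-log det Y^EE` over `Λ(x)`. -/
def IsAnalyticCenter {q : ℕ} (E : Matrix (Fin m) (Fin q) ℝ) (x : EuclideanSpace ℝ (Fin n))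
    (Y : Matrix (Fin m) (Fin m) ℝ) (z : EuclideanSpace ℝ (Fin s)) : Prop :=
  (Y, z) ∈ P.multipliers x ∧
    ∀ Y' z', (Y', z') ∈ P.multipliers x → analyticObjective E Y ≤ analyticObjective E Y'

/-- The subspace `𝒰 = {d | ΔG^EE(x; d) = 0, ∇h(x)ᵀ d = 0}`. -/
def subspaceU {q : ℕ} (E : Matrix (Fin m) (Fin q) ℝ) (x : EuclideanSpace ℝ (Fin n)) :
    Submodule ℝ (EuclideanSpace ℝ (Fin n)) where
  carrier := {d | Eᵀ * P.deltaG x d * E = 0 ∧ (P.gradH x)ᵀ *ᵥ d.ofLp = 0}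
  zero_mem' := by simp [deltaG]
  add_mem' := by
    rintro a b ⟨ha, ha'⟩ ⟨hb, hb'⟩
    have hab : P.deltaG x (a + b) = P.deltaG x a + P.deltaG x b := by
      simp [deltaG, add_smul, Finset.sum_add_distrib]
    exact ⟨by rw [hab, Matrix.mul_add, Matrix.add_mul, ha, hb, add_zero],
      by rw [WithLp.ofLp_add, Matrix.mulVec_add, ha', hb', add_zero]⟩
  smul_mem' := by
    rintro c a ⟨ha, ha'⟩
    have hca : P.deltaG x (c • a) = c • P.deltaG x a := by
      simp [deltaG, mul_smul, Finset.smul_sum]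
    exact ⟨by rw [hca, Matrix.mul_smul, Matrix.smul_mul, ha, smul_zero],
      by rw [WithLp.ofLp_smul, Matrix.mulVec_smul, ha', smul_zero]⟩

/-- `(Δx, ΔY) ∈ ℝⁿ × 𝕊^m` solves the linear system
`Uᵀ (∇²_xx L(x, Y, z) Δx - 𝒥G(x)^* ΔY) = 0`, `𝓛_{G(x)} ΔY + 𝓛_Y ΔG(x; Δx) = 2 I`,
`∇h(x)ᵀ Δx = 0`. -/
structure SolvesTangentSystem {p : ℕ} (U : Matrix (Fin n) (Fin p) ℝ)
    (x : EuclideanSpace ℝ (Fin n)) (Y : Matrix (Fin m) (Fin m) ℝ) (z : EuclideanSpace ℝ (Fin s))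
    (Δx : EuclideanSpace ℝ (Fin n)) (ΔY : Matrix (Fin m) (Fin m) ℝ) : Prop where
  symm : ΔY.IsSymm
  eq_L : Uᵀ *ᵥ (P.hessL x Y z *ᵥ Δx.ofLp - P.adjG x ΔY) = 0
  eq_G : symMul (P.G x) ΔY + symMul Y (P.deltaG x Δx) = (2 : ℝ) • (1 : Matrix (Fin m) (Fin m) ℝ)
  eq_h : (P.gradH x)ᵀ *ᵥ Δx.ofLp = 0

end NSDP

end

/-! ### Positive semidefinite matrices -/

section PosSemidef

open scoped MatrixOrder

/-! The point is that (x^k - x*)/μ_k converges to a nonzero vector ξ*; normalization then removes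
μ_k.

Along an ultrafilter, MFCQ keeps the multipliers bounded (`exists_tendsto_multipliers`), so they
converge to some (Y₀, z₀) in Λ(x*). Two limits are then taken, with any scaling c_k for which c_k
(x^k - x*) → e. At first order, compressing G(x^k) Y_k = μ_k I by E gives (Eᵀ ΔG(e) E)(Eᵀ Y₀ E) =
(lim c_k μ_k) I (`conj_deltaG_mul_conj_eq`). At second order, testing stationarity with u ∈ 𝒰 gives
uᵀ(∇²L + Ω)e = lim c_k μ_k ΔG(u) • G(x*)† (`tendsto_mul_matInner_pinv`); the sigma term comes from
the blocks of Y_k outside the null space of G(x*).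

If c_k μ_k → 0, strict complementarity puts e in 𝒰, the quadratic form vanishes at e, and the
second-order condition forces e = 0. Hence ‖x^k - x*‖ = O(μ_k), and c_k = 1/μ_k gives a limit d. The
first-order relation then says that Eᵀ ΔG(d) E inverts Eᵀ Y₀ E. Since ΔG(d) • Y is constant on
Λ(x*), this is the optimality condition for the determinant, and equality in AM-GM identifies Y₀ as
the only analytic center (`IsKKT.eq_of_det_le`). The second-order relation says that d solves the
tangent system, whose Δx-component is unique by the second-order condition. So d does not depend on
the ultrafilter, and the whole sequence converges. -/

theorem Matrix.PosSemidef.exists_transpose_mul_self {m : ℕ} {A : Matrix (Fin m) (Fin m) ℝ}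
    (hA : A.PosSemidef) : ∃ C : Matrix (Fin m) (Fin m) ℝ, A = Cᵀ * C := by
  obtain ⟨C, hC⟩ := CStarAlgebra.nonneg_iff_eq_star_mul_self.mp hA.nonneg
  exact ⟨C, by rw [hC, Matrix.star_eq_conjTranspose,
    Matrix.conjTranspose_eq_transpose_of_trivial]⟩

end PosSemidef

theorem Matrix.PosSemidef.transpose_mul_mul_same {m q : ℕ} {A : Matrix (Fin m) (Fin m) ℝ}
    (hA : A.PosSemidef) (B : Matrix (Fin m) (Fin q) ℝ) : (Bᵀ * A * B).PosSemidef := by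
  have := hA.conjTranspose_mul_mul_same B
  rwa [Matrix.conjTranspose_eq_transpose_of_trivial] at this

theorem Matrix.PosSemidef.isSymm {m : ℕ} {A : Matrix (Fin m) (Fin m) ℝ}
    (hA : A.PosSemidef) : A.IsSymm := by
  have := hA.isHermitian
  rwa [Matrix.IsHermitian, Matrix.conjTranspose_eq_transpose_of_trivial] at this

/-- With A = DᵀD and B = CᵀC, the trace is the squared Frobenius norm of D Cᵀ. -/
theorem Matrix.PosSemidef.mul_eq_zero_of_trace {m : ℕ} {A B : Matrix (Fin m) (Fin m) ℝ}
    (hA : A.PosSemidef) (hB : B.PosSemidef) (h : (A * B).trace = 0) : A * B = 0 := by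
  obtain ⟨C, rfl⟩ := hB.exists_transpose_mul_self
  obtain ⟨D, rfl⟩ := hA.exists_transpose_mul_self
  have h2 : D * Cᵀ = 0 := by
    rw [← Matrix.trace_conjTranspose_mul_self_eq_zero_iff,
      Matrix.conjTranspose_eq_transpose_of_trivial, Matrix.transpose_mul, Matrix.transpose_transpose]
    rw [show C * Dᵀ * (D * Cᵀ) = C * (Dᵀ * D * Cᵀ) by simp only [Matrix.mul_assoc],
      Matrix.trace_mul_comm]
    simpa [Matrix.mul_assoc] using h
  calc Dᵀ * D * (Cᵀ * C) = Dᵀ * (D * Cᵀ) * C := by simp only [Matrix.mul_assoc]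
    _ = 0 := by rw [h2]; simp

/-- Pairing AS + SA = 0 with S, where A = CᵀC, gives 2‖CS‖² = 0 in the Frobenius norm. -/
theorem Matrix.PosSemidef.mul_eq_zero_of_symMul_eq_zero {m : ℕ} {A S : Matrix (Fin m) (Fin m) ℝ}
    (hA : A.PosSemidef) (hS : S.IsSymm) (h : symMul A S = 0) : A * S = 0 := by
  obtain ⟨C, rfl⟩ := hA.exists_transpose_mul_self
  have h1 : (S * (Cᵀ * C * S)).trace = 0 := by
    have h2 := congrArg (fun M => (S * M).trace) h
    simp only [symMul, Matrix.mul_add, Matrix.trace_add, Matrix.mul_zero, Matrix.trace_zero] at h2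
    rw [Matrix.trace_mul_comm S (S * (Cᵀ * C)), Matrix.mul_assoc S (Cᵀ * C)] at h2
    linarith
  have h2 : C * S = 0 := by
    rw [← Matrix.trace_conjTranspose_mul_self_eq_zero_iff,
      Matrix.conjTranspose_eq_transpose_of_trivial, Matrix.transpose_mul, hS.eq]
    simpa only [Matrix.mul_assoc] using h1
  rw [Matrix.mul_assoc, h2, Matrix.mul_zero]

theorem Matrix.PosDef.eq_zero_of_mul_eq_zero {m r : ℕ} {A : Matrix (Fin m) (Fin m) ℝ}
    {S : Matrix (Fin m) (Fin r) ℝ} (hA : A.PosDef) (h : A * S = 0) : S = 0 := by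
  obtain ⟨M, hM⟩ := hA.isUnit
  rw [← hM] at h
  simpa [← Matrix.mul_assoc] using congrArg (fun t => (↑M⁻¹ : Matrix (Fin m) (Fin m) ℝ) * t) h

theorem Matrix.PosSemidef.of_tendsto {ι : Type*} {l : Filter ι} [l.NeBot] {m : ℕ}
    {A : ι → Matrix (Fin m) (Fin m) ℝ} {B : Matrix (Fin m) (Fin m) ℝ}
    (hA : ∀ i, (A i).PosSemidef) (h : Filter.Tendsto A l (𝓝 B)) : B.PosSemidef := by
  refine Matrix.PosSemidef.of_dotProduct_mulVec_nonneg ?_ fun v => ?_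
  · have h1 : Filter.Tendsto (fun i => (A i)ᵀ) l (𝓝 Bᵀ) :=
      (continuous_id.matrix_transpose.tendsto B).comp h
    have h2 : (fun i => (A i)ᵀ) = A := funext fun i => (hA i).isSymm
    rw [h2] at h1
    rw [Matrix.IsHermitian, Matrix.conjTranspose_eq_transpose_of_trivial]
    exact tendsto_nhds_unique h1 h
  · have h1 : Filter.Tendsto (fun i => star v ⬝ᵥ (A i *ᵥ v)) l (𝓝 (star v ⬝ᵥ (B *ᵥ v))) :=
      ((continuous_const.dotProduct
        (continuous_id.matrix_mulVec continuous_const)).tendsto B).comp h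
    exact ge_of_tendsto' h1 fun i => (hA i).dotProduct_mulVec_nonneg v

/-- Equality case of AM-GM: log λ ≤ λ - 1 is strict unless λ = 1, while the sum of λ - 1 is zero and
the sum of log λ is nonnegative. -/
theorem Matrix.PosSemidef.eq_one_of_trace_of_det {q : ℕ} {M : Matrix (Fin q) (Fin q) ℝ}
    (hM : M.PosSemidef) (ht : M.trace = q) (hd : 1 ≤ M.det) : M = 1 := by
  have hs : ∑ i, (hM.1.eigenvalues i - 1) = 0 := by
    have := hM.1.trace_eq_sum_eigenvalues
    rw [ht] at this
    simp only [Finset.sum_sub_distrib, Finset.sum_const, Finset.card_univ, Fintype.card_fin]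
    simp at this ⊢
    linarith
  have hp : 1 ≤ ∏ i, hM.1.eigenvalues i := by
    have := hM.1.det_eq_prod_eigenvalues
    simp at this
    rwa [← this]
  have hpos : ∀ i, 0 < hM.1.eigenvalues i := by
    intro i
    refine lt_of_le_of_ne (hM.eigenvalues_nonneg i) fun h => ?_
    rw [Finset.prod_eq_zero (Finset.mem_univ i) h.symm] at hp
    linarith
  have hlog : 0 ≤ ∑ i, Real.log (hM.1.eigenvalues i) := by
    rw [← Real.log_prod (fun i _ => (hpos i).ne')]
    exact Real.log_nonneg hp
  have hone : ∀ i, hM.1.eigenvalues i = 1 := by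
    by_contra! hne
    obtain ⟨i, hi⟩ := hne
    have : ∑ i, Real.log (hM.1.eigenvalues i) < ∑ i, (hM.1.eigenvalues i - 1) :=
      Finset.sum_lt_sum (fun j _ => Real.log_le_sub_one_of_pos (hpos j))
        ⟨i, Finset.mem_univ i, Real.log_lt_sub_one_of_pos (hpos i) hi⟩
    linarith
  have h := hM.1.spectral_theorem
  have h1 : (RCLike.ofReal ∘ hM.1.eigenvalues : Fin q → ℝ) = 1 := by
    funext i; simp [hone i]
  rw [h1, show Matrix.diagonal (1 : Fin q → ℝ) = 1 from Matrix.diagonal_one, map_one] at h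
  exact h

/-- Among the positive semidefinite `B` with `tr (A⁻¹ B) = q`, only `A` has maximal determinant. -/
theorem Matrix.PosSemidef.eq_of_trace_of_det_le {q : ℕ} {A B S : Matrix (Fin q) (Fin q) ℝ}
    (hS : S.PosSemidef) (hSA : S * A = 1) (hB : B.PosSemidef) (ht : (S * B).trace = q)
    (hd : A.det ≤ B.det) : B = A := by
  -- Conjugation by a factor C of S moves A to the identity and B to a matrix of trace q and
  -- determinant at least 1.
  obtain ⟨C, rfl⟩ := hS.exists_transpose_mul_self
  have hdet : (Cᵀ * C).det * A.det = 1 := by rw [← Matrix.det_mul, hSA, Matrix.det_one]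
  have hM : (C * B * Cᵀ).PosSemidef := by
    simpa using hB.transpose_mul_mul_same Cᵀ
  have h1 : C * B * Cᵀ = 1 := by
    refine hM.eq_one_of_trace_of_det ?_ ?_
    · rw [Matrix.trace_mul_comm, ← Matrix.mul_assoc, ht]
    · have : (C * B * Cᵀ).det = (Cᵀ * C).det * B.det := by
        simp only [Matrix.det_mul]; ring
      rw [this, ← hdet]
      exact mul_le_mul_of_nonneg_left hd hS.det_nonneg
  have h2 : Cᵀ * (C * B) = 1 := by
    rw [mul_eq_one_comm]; exact h1
  have h3 : B * (Cᵀ * C) = 1 := by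
    rw [mul_eq_one_comm, Matrix.mul_assoc]; exact h2
  calc B = B * ((Cᵀ * C) * A) := by rw [hSA, Matrix.mul_one]
    _ = A := by rw [← Matrix.mul_assoc, h3, Matrix.one_mul]

/-! ### Orthonormal bases of null spaces -/

theorem IsOrthonormalBasisMatrix.transpose_mul_self {a b : ℕ} {A : Matrix (Fin a) (Fin b) ℝ}
    {S : Submodule ℝ (EuclideanSpace ℝ (Fin a))} (h : IsOrthonormalBasisMatrix A S) :
    Aᵀ * A = 1 := by
  ext i j
  have := orthonormal_iff_ite.mp h.1 j i
  simp only [EuclideanSpace.inner_eq_star_dotProduct, Matrix.col] at this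
  simp only [Matrix.mul_apply, Matrix.transpose_apply, Matrix.one_apply]
  simp only [dotProduct, star_trivial, Matrix.transpose_apply] at this
  rw [this]
  simp [eq_comm]

theorem IsOrthonormalBasisMatrix.col_mem {a b : ℕ} {A : Matrix (Fin a) (Fin b) ℝ}
    {S : Submodule ℝ (EuclideanSpace ℝ (Fin a))} (h : IsOrthonormalBasisMatrix A S) (j : Fin b) :
    WithLp.toLp 2 (A.col j) ∈ S := by
  rw [← h.2]
  exact Submodule.subset_span ⟨j, rfl⟩

theorem IsOrthonormalBasisMatrix.exists_mulVec {a b : ℕ} {A : Matrix (Fin a) (Fin b) ℝ}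
    {S : Submodule ℝ (EuclideanSpace ℝ (Fin a))} (h : IsOrthonormalBasisMatrix A S)
    {v : EuclideanSpace ℝ (Fin a)} (hv : v ∈ S) : ∃ c : Fin b → ℝ, v.ofLp = A *ᵥ c := by
  rw [← h.2] at hv
  obtain ⟨c, hc⟩ := (Submodule.mem_span_range_iff_exists_fun ℝ).mp hv
  refine ⟨c, ?_⟩
  rw [← hc]
  ext i
  simp [Matrix.mulVec, dotProduct, mul_comm]

theorem IsOrthonormalBasisMatrix.mul_eq_zero {m q : ℕ} {G : Matrix (Fin m) (Fin m) ℝ}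
    {E : Matrix (Fin m) (Fin q) ℝ} (hE : IsOrthonormalBasisMatrix E (matrixNullSpace G)) :
    G * E = 0 := by
  ext i j
  have h := hE.col_mem j
  rw [matrixNullSpace, LinearMap.mem_ker] at h
  have h2 := congrArg (fun w : EuclideanSpace ℝ (Fin m) => w i) h
  simpa [Matrix.mulVec, dotProduct, Matrix.mul_apply] using h2

theorem IsOrthonormalBasisMatrix.proj_mul_of_mul_eq_zero {m q r : ℕ}
    {G : Matrix (Fin m) (Fin m) ℝ}
    {E : Matrix (Fin m) (Fin q) ℝ} (hE : IsOrthonormalBasisMatrix E (matrixNullSpace G))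
    {B : Matrix (Fin m) (Fin r) ℝ} (hB : G * B = 0) : E * Eᵀ * B = B := by
  have hcol : ∀ j, ∃ c : Fin q → ℝ, B.col j = E *ᵥ c := by
    intro j
    refine hE.exists_mulVec (v := WithLp.toLp 2 (B.col j)) ?_
    rw [matrixNullSpace, LinearMap.mem_ker]
    ext i
    have := congrFun (congrFun hB i) j
    simpa [Matrix.mulVec, dotProduct, Matrix.mul_apply] using this
  choose c hc using hcol
  have hB' : B = E * (Matrix.of c)ᵀ := by
    ext i j
    have := congrFun (hc j) i
    simpa [Matrix.mulVec, dotProduct, Matrix.mul_apply] using this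
  rw [hB', Matrix.mul_assoc, ← Matrix.mul_assoc Eᵀ, hE.transpose_mul_self, Matrix.one_mul]

/-- Transposing the Penrose equations of a symmetric A permutes them, so uniqueness applies. -/
theorem pinv_isSymm {m : ℕ} {A : Matrix (Fin m) (Fin m) ℝ} (hA : A.IsSymm) : (pinv A).IsSymm := by
  have hH : A.IsHermitian := by
    rwa [Matrix.IsHermitian, Matrix.conjTranspose_eq_transpose_of_trivial]
  have h := pinv_isMoorePenrose hH
  have hA' : Aᵀ = A := hA
  refine IsMoorePenrose.unique (A := A) ⟨?_, ?_, ?_, ?_⟩ h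
  · have := congrArg Matrix.transpose h.mul_mul_left
    simpa [Matrix.transpose_mul, hA', Matrix.mul_assoc] using this
  · have := congrArg Matrix.transpose h.mul_mul_right
    simpa [Matrix.transpose_mul, hA', Matrix.mul_assoc] using this
  · have := h.symm_right
    rw [Matrix.transpose_mul, hA'] at this
    rw [Matrix.transpose_mul, Matrix.transpose_transpose, hA', this]
  · have := h.symm_left
    rw [Matrix.transpose_mul, hA'] at this
    rw [Matrix.transpose_mul, Matrix.transpose_transpose, hA', this]

theorem mul_pinv_comm {m : ℕ} {A : Matrix (Fin m) (Fin m) ℝ} (hA : A.IsSymm) :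
    A * pinv A = pinv A * A := by
  have hH : A.IsHermitian := by
    rwa [Matrix.IsHermitian, Matrix.conjTranspose_eq_transpose_of_trivial]
  have h := (pinv_isMoorePenrose hH).symm_left
  rw [Matrix.transpose_mul, hA.eq, (pinv_isSymm hA).eq] at h
  exact h.symm

/-- Both sides are the orthogonal projection onto the null space. This ties E to the pseudoinverse
and makes 1 = E Eᵀ + G†G the block decomposition used below. -/
theorem IsOrthonormalBasisMatrix.proj_eq {m q : ℕ} {G : Matrix (Fin m) (Fin m) ℝ}
    {E : Matrix (Fin m) (Fin q) ℝ} (hE : IsOrthonormalBasisMatrix E (matrixNullSpace G))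
    (hG : G.IsSymm) : E * Eᵀ = 1 - pinv G * G := by
  have hH : G.IsHermitian := by
    rwa [Matrix.IsHermitian, Matrix.conjTranspose_eq_transpose_of_trivial]
  have h := pinv_isMoorePenrose hH
  have h1 := hE.proj_mul_of_mul_eq_zero (B := 1 - pinv G * G)
    (by rw [Matrix.mul_sub, Matrix.mul_one, ← Matrix.mul_assoc, h.mul_mul_left, sub_self])
  have h2 : Eᵀ * (pinv G * G) = 0 := by
    rw [← mul_pinv_comm hG, ← Matrix.mul_assoc]
    have := congrArg Matrix.transpose hE.mul_eq_zero
    rw [Matrix.transpose_mul, hG.eq, Matrix.transpose_zero] at this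
    rw [this, Matrix.zero_mul]
  rw [Matrix.mul_sub, Matrix.mul_one, Matrix.mul_assoc, h2, Matrix.mul_zero, sub_zero] at h1
  exact h1

/-! ### Derivatives in coordinates -/

theorem fderiv_eq_sum_partialDeriv {n : ℕ} (g : EuclideanSpace ℝ (Fin n) → ℝ)
    (x e : EuclideanSpace ℝ (Fin n)) : fderiv ℝ g x e = ∑ i, e i * partialDeriv g i x := by
  conv_lhs => rw [← (EuclideanSpace.basisFun (Fin n) ℝ).sum_repr e]
  simp [partialDeriv]

theorem ContDiff.partialDeriv {n : ℕ} {g : EuclideanSpace ℝ (Fin n) → ℝ} (hg : ContDiff ℝ 2 g)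
    (i : Fin n) : ContDiff ℝ 1 (fun y => partialDeriv g i y) := by
  unfold _root_.partialDeriv
  exact (hg.fderiv_right (m := 1) (by norm_num)).clm_apply contDiff_const

theorem ContDiff.differentiableAt_partialDeriv {n : ℕ} {g : EuclideanSpace ℝ (Fin n) → ℝ}
    (hg : ContDiff ℝ 2 g) (i : Fin n) (x : EuclideanSpace ℝ (Fin n)) :
    DifferentiableAt ℝ (fun y => _root_.partialDeriv g i y) x :=
  ((hg.partialDeriv i).differentiable (by norm_num)).differentiableAt

theorem hessianMatrix_transpose {n : ℕ} {g : EuclideanSpace ℝ (Fin n) → ℝ} (hg : ContDiff ℝ 2 g)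
    (x : EuclideanSpace ℝ (Fin n)) : (hessianMatrix g x)ᵀ = hessianMatrix g x := by
  have hd : DifferentiableAt ℝ (fderiv ℝ g) x :=
    ((hg.fderiv_right (m := 1) (by norm_num)).differentiable (by norm_num)).differentiableAt
  have key : ∀ i j, hessianMatrix g x i j
      = fderiv ℝ (fderiv ℝ g) x (EuclideanSpace.single i 1) (EuclideanSpace.single j 1) := by
    intro i j
    simp only [hessianMatrix, Matrix.of_apply, partialDeriv]
    rw [fderiv_clm_apply hd (differentiableAt_const _)]
    simp
  ext i j
  rw [Matrix.transpose_apply, key, key]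
  exact hg.contDiffAt.isSymmSndFDerivAt (by simp) _ _

/-! ### Difference quotients and derivatives of the problem data -/

section Limits

variable {ι : Type*} {l : Filter ι} {n : ℕ} {x : ι → EuclideanSpace ℝ (Fin n)}
  {xstar e : EuclideanSpace ℝ (Fin n)} {c : ι → ℝ}

/-- The scaling c is left free because three are needed: 1/(‖x - x*‖ + μ), 1/μ and 1/‖x - x*‖. -/
theorem DifferentiableAt.tendsto_mul_sub {g : EuclideanSpace ℝ (Fin n) → ℝ}
    (hg : DifferentiableAt ℝ g xstar) (hx : Filter.Tendsto x l (𝓝 xstar))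
    (hc : Filter.Tendsto (fun k => c k • (x k - xstar)) l (𝓝 e)) :
    Filter.Tendsto (fun k => c k * (g (x k) - g xstar)) l (𝓝 (fderiv ℝ g xstar e)) := by
  have h0 : Filter.Tendsto (fun k => x k - xstar) l (𝓝 0) := by
    simpa using hx.sub_const xstar
  have h := (hg.hasFDerivAt.hasFDerivWithinAt (s := Set.univ)).lim h0 (by simp) hc
  simpa using h

namespace NSDP

variable {m s : ℕ} (P : NSDP n m s)

theorem deltaG_apply (x d : EuclideanSpace ℝ (Fin n)) (a b : Fin m) :
    P.deltaG x d a b = fderiv ℝ (fun y => P.G y a b) x d := by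
  rw [fderiv_eq_sum_partialDeriv]
  simp [deltaG, Matrix.sum_apply, partialG]

theorem deltaG_isSymm (x d : EuclideanSpace ℝ (Fin n)) : (P.deltaG x d).IsSymm := by
  ext a b
  rw [Matrix.transpose_apply, deltaG_apply, deltaG_apply]
  congr 2
  funext y
  exact (P.G_symm y).apply a b

theorem deltaG_sub (x d e : EuclideanSpace ℝ (Fin n)) :
    P.deltaG x (d - e) = P.deltaG x d - P.deltaG x e := by
  simp [deltaG, sub_smul]

theorem gradH_transpose_mulVec (x d : EuclideanSpace ℝ (Fin n)) (j : Fin s) :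
    ((P.gradH x)ᵀ *ᵥ d.ofLp) j = fderiv ℝ (fun y => P.h y j) x d := by
  rw [fderiv_eq_sum_partialDeriv]
  simp [gradH, Matrix.mulVec, dotProduct, mul_comm]

theorem contDiff_h_apply (j : Fin s) : ContDiff ℝ 2 (fun y => P.h y j) :=
  contDiff_euclidean.mp P.contDiff_h j

theorem adjG_dotProduct (x d : EuclideanSpace ℝ (Fin n)) (Y : Matrix (Fin m) (Fin m) ℝ) :
    P.adjG x Y ⬝ᵥ d.ofLp = matInner (P.deltaG x d) Y := by
  simp [adjG, matInner, deltaG, dotProduct, Finset.sum_mul, Matrix.trace_sum, mul_comm]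

theorem gradL_dotProduct (x d : EuclideanSpace ℝ (Fin n)) (Y : Matrix (Fin m) (Fin m) ℝ)
    (z : EuclideanSpace ℝ (Fin s)) :
    P.gradL x Y z ⬝ᵥ d.ofLp = P.gradF x ⬝ᵥ d.ofLp - matInner (P.deltaG x d) Y
      + z.ofLp ⬝ᵥ ((P.gradH x)ᵀ *ᵥ d.ofLp) := by
  rw [gradL, add_dotProduct, sub_dotProduct, adjG_dotProduct, Matrix.dotProduct_mulVec,
    Matrix.vecMul_transpose]

theorem contDiff_lagrangian (Y : Matrix (Fin m) (Fin m) ℝ) (z : EuclideanSpace ℝ (Fin s)) :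
    ContDiff ℝ 2 (fun y => P.lagrangian y Y z) := by
  unfold lagrangian matInner
  simp only [Matrix.trace, Matrix.diag, Matrix.mul_apply]
  refine (P.contDiff_f.sub (ContDiff.sum fun a _ => ContDiff.sum fun b _ =>
    (P.contDiff_G a b).mul contDiff_const)).add
    (ContDiff.sum fun j _ => (P.contDiff_h_apply j).mul contDiff_const)

theorem gradL_apply (x : EuclideanSpace ℝ (Fin n)) (Y : Matrix (Fin m) (Fin m) ℝ)
    (z : EuclideanSpace ℝ (Fin s)) (i : Fin n) :
    P.gradL x Y z i = partialDeriv P.f i x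
      - ∑ a, ∑ b, partialDeriv (fun y => P.G y a b) i x * Y b a
      + ∑ j, partialDeriv (fun y => P.h y j) i x * z j := by
  simp [gradL, gradF, adjG, matInner, partialG, gradH, Matrix.mulVec, dotProduct, Matrix.trace,
    Matrix.mul_apply]

theorem hasFDerivAt_lagrangian (x : EuclideanSpace ℝ (Fin n)) (Y : Matrix (Fin m) (Fin m) ℝ)
    (z : EuclideanSpace ℝ (Fin s)) :
    HasFDerivAt (fun y => P.lagrangian y Y z) (fderiv ℝ P.f x
      - ∑ a, ∑ b, Y b a • fderiv ℝ (fun y => P.G y a b) x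
      + ∑ j, z j • fderiv ℝ (fun y => P.h y j) x) x := by
  unfold lagrangian matInner
  simp only [Matrix.trace, Matrix.diag, Matrix.mul_apply]
  refine HasFDerivAt.add (HasFDerivAt.sub ?_ ?_) ?_
  · exact (P.contDiff_f.differentiable (by norm_num)).differentiableAt.hasFDerivAt
  · exact HasFDerivAt.fun_sum fun a _ => HasFDerivAt.fun_sum fun b _ =>
      ((P.contDiff_G a b).differentiable (by norm_num)).differentiableAt.hasFDerivAt.mul_const _
  · exact HasFDerivAt.fun_sum fun j _ =>
      ((P.contDiff_h_apply j).differentiable (by norm_num)).differentiableAt.hasFDerivAt.mul_const _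

theorem partialDeriv_lagrangian (x : EuclideanSpace ℝ (Fin n)) (Y : Matrix (Fin m) (Fin m) ℝ)
    (z : EuclideanSpace ℝ (Fin s)) (i : Fin n) :
    partialDeriv (fun y => P.lagrangian y Y z) i x = P.gradL x Y z i := by
  rw [partialDeriv, (P.hasFDerivAt_lagrangian x Y z).fderiv, gradL_apply]
  simp [partialDeriv, mul_comm]

theorem hasFDerivAt_gradL (x : EuclideanSpace ℝ (Fin n)) (Y : Matrix (Fin m) (Fin m) ℝ)
    (z : EuclideanSpace ℝ (Fin s)) (i : Fin n) :
    HasFDerivAt (fun y => P.gradL y Y z i) (fderiv ℝ (fun y => partialDeriv P.f i y) x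
      - ∑ a, ∑ b, Y b a • fderiv ℝ (fun y => partialDeriv (fun y => P.G y a b) i y) x
      + ∑ j, z j • fderiv ℝ (fun y => partialDeriv (fun y => P.h y j) i y) x) x := by
  simp only [gradL_apply]
  refine HasFDerivAt.add (HasFDerivAt.sub ?_ ?_) ?_
  · exact (P.contDiff_f.differentiableAt_partialDeriv i x).hasFDerivAt
  · exact HasFDerivAt.fun_sum fun a _ => HasFDerivAt.fun_sum fun b _ =>
      ((P.contDiff_G a b).differentiableAt_partialDeriv i x).hasFDerivAt.mul_const _
  · exact HasFDerivAt.fun_sum fun j _ =>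
      ((P.contDiff_h_apply j).differentiableAt_partialDeriv i x).hasFDerivAt.mul_const _

theorem hessL_mulVec (x e : EuclideanSpace ℝ (Fin n)) (Y : Matrix (Fin m) (Fin m) ℝ)
    (z : EuclideanSpace ℝ (Fin s)) (i : Fin n) :
    (P.hessL x Y z *ᵥ e.ofLp) i = fderiv ℝ (fun y => P.gradL y Y z i) x e := by
  rw [fderiv_eq_sum_partialDeriv, hessL, ← hessianMatrix_transpose (P.contDiff_lagrangian Y z)]
  simp [Matrix.mulVec, dotProduct, hessianMatrix, partialDeriv_lagrangian, mul_comm]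

theorem tendsto_smul_G_sub (hx : Filter.Tendsto x l (𝓝 xstar))
    (hc : Filter.Tendsto (fun k => c k • (x k - xstar)) l (𝓝 e)) :
    Filter.Tendsto (fun k => c k • (P.G (x k) - P.G xstar)) l (𝓝 (P.deltaG xstar e)) := by
  refine tendsto_pi_nhds.mpr fun a => tendsto_pi_nhds.mpr fun b => ?_
  rw [deltaG_apply]
  exact ((P.contDiff_G a b).differentiable (by norm_num)).differentiableAt.tendsto_mul_sub hx hc

theorem gradH_transpose_mulVec_eq_zero [l.NeBot] (hx : Filter.Tendsto x l (𝓝 xstar))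
    (hc : Filter.Tendsto (fun k => c k • (x k - xstar)) l (𝓝 e))
    (hh : ∀ k, P.h (x k) = 0) (hh' : P.h xstar = 0) : (P.gradH xstar)ᵀ *ᵥ e.ofLp = 0 := by
  funext j
  rw [gradH_transpose_mulVec]
  have := ((P.contDiff_h_apply j).differentiable (by norm_num)).differentiableAt.tendsto_mul_sub
    hx hc
  simp only [hh, hh', sub_self, mul_zero] at this
  exact tendsto_nhds_unique this tendsto_const_nhds

/-- The gradient is affine in (Y, z), so the multipliers may vary with k: they only multiply
difference quotients that converge on their own. -/
theorem tendsto_smul_gradL_sub {Y : ι → Matrix (Fin m) (Fin m) ℝ} {Y₀ : Matrix (Fin m) (Fin m) ℝ}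
    {z : ι → EuclideanSpace ℝ (Fin s)} {z₀ : EuclideanSpace ℝ (Fin s)}
    (hx : Filter.Tendsto x l (𝓝 xstar))
    (hc : Filter.Tendsto (fun k => c k • (x k - xstar)) l (𝓝 e))
    (hY : Filter.Tendsto Y l (𝓝 Y₀)) (hz : Filter.Tendsto z l (𝓝 z₀)) :
    Filter.Tendsto (fun k => c k • (P.gradL (x k) (Y k) (z k) - P.gradL xstar (Y k) (z k))) l
      (𝓝 (P.hessL xstar Y₀ z₀ *ᵥ e.ofLp)) := by
  refine tendsto_pi_nhds.mpr fun i => ?_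
  rw [hessL_mulVec, (P.hasFDerivAt_gradL xstar Y₀ z₀ i).fderiv]
  have hYab : ∀ a b, Filter.Tendsto (fun k => Y k b a) l (𝓝 (Y₀ b a)) := fun a b =>
    tendsto_pi_nhds.mp (tendsto_pi_nhds.mp hY b) a
  have hzj : ∀ j, Filter.Tendsto (fun k => z k j) l (𝓝 (z₀ j)) := fun j =>
    ((EuclideanSpace.proj (𝕜 := ℝ) j).continuous.tendsto z₀).comp hz
  have h1 := (P.contDiff_f.differentiableAt_partialDeriv i xstar).tendsto_mul_sub hx hc
  have h2 := tendsto_finsetSum (f := fun a k => ∑ b, Y k b a * (c k *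
    (partialDeriv (fun y => P.G y a b) i (x k) - partialDeriv (fun y => P.G y a b) i xstar)))
    Finset.univ fun a _ => tendsto_finsetSum Finset.univ fun b _ => (hYab a b).mul
      (((P.contDiff_G a b).differentiableAt_partialDeriv i xstar).tendsto_mul_sub hx hc)
  have h3 := tendsto_finsetSum (f := fun j k => z k j * (c k *
    (partialDeriv (fun y => P.h y j) i (x k) - partialDeriv (fun y => P.h y j) i xstar)))
    Finset.univ fun j _ => (hzj j).mul
      (((P.contDiff_h_apply j).differentiableAt_partialDeriv i xstar).tendsto_mul_sub hx hc)
  convert (h1.sub h2).add h3 using 1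
  · funext k
    simp only [Pi.smul_apply, Pi.sub_apply, gradL_apply, smul_eq_mul]
    rw [show ∀ A B C A' B' C' : ℝ, c k * (A - B + C - (A' - B' + C'))
      = c k * (A - A') - c k * (B - B') + c k * (C - C') by intros; ring,
      ← Finset.sum_sub_distrib, ← Finset.sum_sub_distrib, Finset.mul_sum, Finset.mul_sum]
    simp only [← Finset.sum_sub_distrib, Finset.mul_sum]
    congr 1
    · congr 1
      exact Finset.sum_congr rfl fun a _ => Finset.sum_congr rfl fun b _ => by ring
    · exact Finset.sum_congr rfl fun a _ => by ring
  · simp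

/-- The part linear in (Y, z) is isolated because the boundedness argument rescales the multipliers,
which makes ∇f disappear in the limit. -/
theorem tendsto_neg_adjG_add_gradH {Y : ι → Matrix (Fin m) (Fin m) ℝ} {Y₀ : Matrix (Fin m) (Fin m) ℝ}
    {z : ι → EuclideanSpace ℝ (Fin s)} {z₀ : EuclideanSpace ℝ (Fin s)}
    (hx : Filter.Tendsto x l (𝓝 xstar))
    (hY : Filter.Tendsto Y l (𝓝 Y₀)) (hz : Filter.Tendsto z l (𝓝 z₀)) :
    Filter.Tendsto (fun k => - P.adjG (x k) (Y k) + P.gradH (x k) *ᵥ (z k).ofLp) l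
      (𝓝 (- P.adjG xstar Y₀ + P.gradH xstar *ᵥ z₀.ofLp)) := by
  refine tendsto_pi_nhds.mpr fun i => ?_
  have hYab : ∀ a b, Filter.Tendsto (fun k => Y k b a) l (𝓝 (Y₀ b a)) := fun a b =>
    tendsto_pi_nhds.mp (tendsto_pi_nhds.mp hY b) a
  have hzj : ∀ j, Filter.Tendsto (fun k => z k j) l (𝓝 (z₀ j)) := fun j =>
    ((EuclideanSpace.proj (𝕜 := ℝ) j).continuous.tendsto z₀).comp hz
  have h2 := tendsto_finsetSum (f := fun a k => ∑ b,
    partialDeriv (fun y => P.G y a b) i (x k) * Y k b a)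
    Finset.univ fun a _ => tendsto_finsetSum Finset.univ fun b _ =>
      (((((P.contDiff_G a b).partialDeriv i).continuous.tendsto xstar).comp hx).mul (hYab a b))
  have h3 := tendsto_finsetSum (f := fun j k => partialDeriv (fun y => P.h y j) i (x k) * z k j)
    Finset.univ fun j _ =>
      (((((P.contDiff_h_apply j).partialDeriv i).continuous.tendsto xstar).comp hx).mul (hzj j))
  simpa [adjG, matInner, partialG, gradH, Matrix.mulVec, dotProduct, Matrix.trace,
    Matrix.mul_apply] using h2.neg.add h3

theorem tendsto_G (hx : Filter.Tendsto x l (𝓝 xstar)) :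
    Filter.Tendsto (fun k => P.G (x k)) l (𝓝 (P.G xstar)) :=
  tendsto_pi_nhds.mpr fun a => tendsto_pi_nhds.mpr fun b =>
    ((P.contDiff_G a b).continuous.tendsto xstar).comp hx

theorem tendsto_gradF (hx : Filter.Tendsto x l (𝓝 xstar)) :
    Filter.Tendsto (fun k => P.gradF (x k)) l (𝓝 (P.gradF xstar)) :=
  tendsto_pi_nhds.mpr fun i => ((P.contDiff_f.partialDeriv i).continuous.tendsto xstar).comp hx

end NSDP

end Limits

namespace NSDP

variable {n m s q : ℕ} {P : NSDP n m s} {xstar : EuclideanSpace ℝ (Fin n)}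
  {E : Matrix (Fin m) (Fin q) ℝ}

/-! ### Multipliers and the null space of `G x` -/

theorem IsKKT.G_mul_eq_zero {Y : Matrix (Fin m) (Fin m) ℝ} {z : EuclideanSpace ℝ (Fin s)}
    (h : P.IsKKT xstar Y z) : P.G xstar * Y = 0 :=
  h.G_posSemidef.mul_eq_zero_of_trace h.Y_posSemidef h.complementary

theorem IsKKT.proj_mul {Y : Matrix (Fin m) (Fin m) ℝ} {z : EuclideanSpace ℝ (Fin s)}
    (hE : IsOrthonormalBasisMatrix E (matrixNullSpace (P.G xstar)))
    (h : P.IsKKT xstar Y z) : E * Eᵀ * Y = Y :=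
  hE.proj_mul_of_mul_eq_zero h.G_mul_eq_zero

theorem IsKKT.mul_proj {Y : Matrix (Fin m) (Fin m) ℝ} {z : EuclideanSpace ℝ (Fin s)}
    (hE : IsOrthonormalBasisMatrix E (matrixNullSpace (P.G xstar)))
    (h : P.IsKKT xstar Y z) : Y * (E * Eᵀ) = Y := by
  have := congrArg Matrix.transpose (h.proj_mul hE)
  simpa [Matrix.transpose_mul, h.Y_posSemidef.isSymm.eq] using this

theorem IsKKT.eq_conj {Y : Matrix (Fin m) (Fin m) ℝ} {z : EuclideanSpace ℝ (Fin s)}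
    (hE : IsOrthonormalBasisMatrix E (matrixNullSpace (P.G xstar)))
    (h : P.IsKKT xstar Y z) : Y = E * (Eᵀ * Y * E) * Eᵀ := by
  have : E * (Eᵀ * Y * E) * Eᵀ = E * Eᵀ * Y * (E * Eᵀ) := by simp only [Matrix.mul_assoc]
  rw [this, h.proj_mul hE, h.mul_proj hE]

theorem IsKKT.conj_posDef {Y : Matrix (Fin m) (Fin m) ℝ}
    (hE : IsOrthonormalBasisMatrix E (matrixNullSpace (P.G xstar)))
    (hpos : (P.G xstar + Y).PosDef) : (Eᵀ * Y * E).PosDef := by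
  have hinj : Function.Injective E.mulVec := by
    intro v w hvw
    have := congrArg (fun t => Eᵀ *ᵥ t) hvw
    simpa [Matrix.mulVec_mulVec, hE.transpose_mul_self] using this
  have h1 := hpos.conjTranspose_mul_mul_same hinj
  rwa [Matrix.conjTranspose_eq_transpose_of_trivial, Matrix.mul_add, Matrix.add_mul,
    Matrix.mul_assoc _ (P.G xstar), hE.mul_eq_zero, Matrix.mul_zero, zero_add] at h1

theorem IsKKT.matInner_eq {Y : Matrix (Fin m) (Fin m) ℝ} {z : EuclideanSpace ℝ (Fin s)}
    (hE : IsOrthonormalBasisMatrix E (matrixNullSpace (P.G xstar)))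
    (h : P.IsKKT xstar Y z) (D : Matrix (Fin m) (Fin m) ℝ) :
    matInner D Y = ((Eᵀ * D * E) * (Eᵀ * Y * E)).trace := by
  conv_lhs => rw [matInner, h.eq_conj hE, ← Matrix.mul_assoc, ← Matrix.mul_assoc,
    Matrix.trace_mul_comm]
  simp only [Matrix.mul_assoc]

/-- The left side does not involve Y: on Λ(x*), ΔG(d) • Y is constant for every d tangent to the
equality constraints. -/
theorem IsKKT.gradF_dotProduct {Y : Matrix (Fin m) (Fin m) ℝ} {z : EuclideanSpace ℝ (Fin s)}
    (h : P.IsKKT xstar Y z) {d : EuclideanSpace ℝ (Fin n)}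
    (hd : (P.gradH xstar)ᵀ *ᵥ d.ofLp = 0) :
    P.gradF xstar ⬝ᵥ d.ofLp = matInner (P.deltaG xstar d) Y := by
  have := P.gradL_dotProduct xstar d Y z
  rw [h.stationary, hd, zero_dotProduct, dotProduct_zero, add_zero] at this
  linarith

/-- The second-order condition is applied only to directions in 𝒰. -/
theorem IsKKT.mem_criticalCone {Y : Matrix (Fin m) (Fin m) ℝ} {z : EuclideanSpace ℝ (Fin s)}
    (hE : IsOrthonormalBasisMatrix E (matrixNullSpace (P.G xstar)))
    (h : P.IsKKT xstar Y z) {u : EuclideanSpace ℝ (Fin n)} (hu : u ∈ P.subspaceU E xstar) :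
    u ∈ P.criticalCone E xstar := by
  obtain ⟨hu1, hu2⟩ := hu
  refine ⟨?_, hu2, P.deltaG_isSymm _ _, by rw [hu1]; exact Matrix.PosSemidef.zero⟩
  rw [h.gradF_dotProduct hu2, h.matInner_eq hE, hu1, Matrix.zero_mul, Matrix.trace_zero]

theorem sigmaTerm_quadratic (x u e : EuclideanSpace ℝ (Fin n)) (Y : Matrix (Fin m) (Fin m) ℝ) :
    u.ofLp ⬝ᵥ (P.sigmaTerm x Y *ᵥ e.ofLp)
      = 2 * matInner Y (P.deltaG x u * pinv (P.G x) * P.deltaG x e) := by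
  simp only [dotProduct, Matrix.mulVec, sigmaTerm, Matrix.of_apply, matInner, deltaG,
    Finset.sum_mul, Finset.mul_sum, Matrix.trace_sum, Matrix.smul_mul,
    Matrix.mul_smul, Matrix.trace_smul, smul_eq_mul]
  rw [Finset.sum_comm]
  refine Finset.sum_congr rfl fun i _ => Finset.sum_congr rfl fun j _ => ?_
  ring

/-- Dual form of MFCQ. Pairing the equation with the MFCQ direction d kills the z-term and gives
ΔG(d) • Y = 0; thus Y is orthogonal to the positive definite G + ΔG(d) and vanishes. Full column
rank then disposes of z. -/
theorem MFCQ.eq_zero (h : P.MFCQ xstar) {Y : Matrix (Fin m) (Fin m) ℝ}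
    {z : EuclideanSpace ℝ (Fin s)} (hY : Y.PosSemidef) (hGY : P.G xstar * Y = 0)
    (hYz : - P.adjG xstar Y + P.gradH xstar *ᵥ z.ofLp = 0) : Y = 0 ∧ z = 0 := by
  obtain ⟨d, hd, hd'⟩ := h.exists_direction
  have h1 : matInner (P.deltaG xstar d) Y = 0 := by
    have := congrArg (fun v => v ⬝ᵥ d.ofLp) hYz
    simp only [add_dotProduct, neg_dotProduct, zero_dotProduct] at this
    rw [adjG_dotProduct, ← Matrix.vecMul_transpose, ← Matrix.dotProduct_mulVec, hd',
      dotProduct_zero] at this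
    linarith
  have h2 : (P.G xstar + P.deltaG xstar d) * Y = 0 := by
    refine hd.posSemidef.mul_eq_zero_of_trace hY ?_
    rw [Matrix.add_mul, hGY, zero_add]
    exact h1
  have hY0 : Y = 0 := hd.eq_zero_of_mul_eq_zero h2
  refine ⟨hY0, ?_⟩
  rw [hY0] at hYz
  have h3 : P.gradH xstar *ᵥ z.ofLp = 0 := by
    have : P.adjG xstar (0 : Matrix (Fin m) (Fin m) ℝ) = 0 := by
      funext i; simp [adjG, matInner]
    simpa [this] using hYz
  have h4 := Matrix.mulVec_injective_iff.mpr h.full_column_rank (h3.trans (Matrix.mulVec_zero _).symm)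
  exact WithLp.ofLp_injective 2 h4

/-! ### Limits of barrier KKT triplets -/

section Limits

variable {ι : Type*} {l : Filter ι} {x : ι → EuclideanSpace ℝ (Fin n)} {μ c : ι → ℝ}
  {Y : ι → Matrix (Fin m) (Fin m) ℝ} {z : ι → EuclideanSpace ℝ (Fin s)}
  {Y₀ : Matrix (Fin m) (Fin m) ℝ} {z₀ : EuclideanSpace ℝ (Fin s)}
  {e : EuclideanSpace ℝ (Fin n)}

theorem isKKT_of_tendsto [l.NeBot] (hMFCQ : P.MFCQ xstar) (hB : ∀ k, P.IsBKKT (μ k) (x k) (Y k) (z k))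
    (hμ : Filter.Tendsto μ l (𝓝 0)) (hx : Filter.Tendsto x l (𝓝 xstar))
    (hY : Filter.Tendsto Y l (𝓝 Y₀)) (hz : Filter.Tendsto z l (𝓝 z₀)) :
    P.IsKKT xstar Y₀ z₀ where
  stationary := by
    have h := (P.tendsto_gradF hx).add (P.tendsto_neg_adjG_add_gradH hx hY hz)
    have h0 : (fun k => P.gradF (x k) + (-P.adjG (x k) (Y k) + P.gradH (x k) *ᵥ (z k).ofLp))
        = fun _ => 0 := by
      funext k
      rw [← (hB k).stationary, gradL]
      abel
    rw [h0] at h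
    rw [tendsto_nhds_unique tendsto_const_nhds h, gradL]
    abel
  complementary := by
    have h := ((continuous_fst.matrix_mul continuous_snd).tendsto (P.G xstar, Y₀)).comp
      ((P.tendsto_G hx).prodMk_nhds hY)
    have h' : Filter.Tendsto (fun k => P.G (x k) * Y k) l
        (𝓝 ((0 : ℝ) • (1 : Matrix (Fin m) (Fin m) ℝ))) := by
      simp only [fun k => (hB k).G_mul_Y]
      exact hμ.smul_const _
    have := tendsto_nhds_unique h h'
    rw [zero_smul] at this
    rw [matInner, this, Matrix.trace_zero]
  G_posSemidef := hMFCQ.G_posSemidef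
  Y_posSemidef := Matrix.PosSemidef.of_tendsto (fun k => (hB k).Y_posDef.posSemidef) hY
  h_eq_zero := hMFCQ.h_eq_zero

theorem tendsto_smul_G_sub_mul (hx : Filter.Tendsto x l (𝓝 xstar))
    (hY : Filter.Tendsto Y l (𝓝 Y₀))
    (hc : Filter.Tendsto (fun k => c k • (x k - xstar)) l (𝓝 e)) :
    Filter.Tendsto (fun k => c k • ((P.G (x k) - P.G xstar) * Y k)) l
      (𝓝 (P.deltaG xstar e * Y₀)) := by
  have h := ((continuous_fst.matrix_mul continuous_snd).tendsto (P.deltaG xstar e, Y₀)).comp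
    ((P.tendsto_smul_G_sub hx hc).prodMk_nhds hY)
  simpa [Function.comp_def, Matrix.smul_mul] using h

/-- Since Eᵀ G(x*) = 0, subtracting G(x*) from G(x^k) does not change the compression of G(x^k) Y_k
= μ_k I, and the difference quotient of G appears. -/
theorem conj_deltaG_mul_conj_eq [l.NeBot] (hE : IsOrthonormalBasisMatrix E (matrixNullSpace (P.G xstar)))
    (hB : ∀ k, P.IsBKKT (μ k) (x k) (Y k) (z k)) (hK : P.IsKKT xstar Y₀ z₀)
    (hx : Filter.Tendsto x l (𝓝 xstar)) (hY : Filter.Tendsto Y l (𝓝 Y₀))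
    (hc : Filter.Tendsto (fun k => c k • (x k - xstar)) l (𝓝 e)) {ν : ℝ}
    (hν : Filter.Tendsto (fun k => c k * μ k) l (𝓝 ν)) :
    (Eᵀ * P.deltaG xstar e * E) * (Eᵀ * Y₀ * E) = ν • (1 : Matrix (Fin q) (Fin q) ℝ) := by
  have hEG : Eᵀ * P.G xstar = 0 := by
    have := congrArg Matrix.transpose hE.mul_eq_zero
    rwa [Matrix.transpose_mul, (P.G_symm xstar).eq, Matrix.transpose_zero] at this
  have hcont : Continuous fun M : Matrix (Fin m) (Fin m) ℝ => Eᵀ * M * E :=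
    (continuous_const.matrix_mul continuous_id).matrix_mul continuous_const
  have h1 := (hcont.tendsto _).comp (tendsto_smul_G_sub_mul (P := P) hx hY hc)
  have h2 : ((fun M : Matrix (Fin m) (Fin m) ℝ => Eᵀ * M * E) ∘
      fun k => c k • ((P.G (x k) - P.G xstar) * Y k)) = fun k => (c k * μ k) •
        (1 : Matrix (Fin q) (Fin q) ℝ) := by
    funext k
    simp only [Function.comp_apply]
    rw [Matrix.mul_smul, Matrix.smul_mul, Matrix.sub_mul, (hB k).G_mul_Y, Matrix.mul_sub,
      ← Matrix.mul_assoc, hEG, Matrix.zero_mul, sub_zero, Matrix.mul_smul, Matrix.mul_one,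
      Matrix.smul_mul, hE.transpose_mul_self, smul_smul]
  rw [h2] at h1
  have h3 := tendsto_nhds_unique h1 (hν.smul_const (1 : Matrix (Fin q) (Fin q) ℝ))
  rw [← h3]
  have := hK.proj_mul hE
  calc (Eᵀ * P.deltaG xstar e * E) * (Eᵀ * Y₀ * E)
      = Eᵀ * P.deltaG xstar e * (E * Eᵀ * Y₀) * E := by simp only [Matrix.mul_assoc]
    _ = _ := by rw [this]; simp only [Matrix.mul_assoc]

theorem _root_.trace_mul_mul_mul_of_isSymm {V Y D N : Matrix (Fin m) (Fin m) ℝ} (hV : V.IsSymm)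
    (hY : Y.IsSymm) (hD : D.IsSymm) (hN : N.IsSymm) :
    (V * (Y * D * N)).trace = (Y * (V * N * D)).trace := by
  rw [← Matrix.trace_transpose,
    show Y * (V * N * D) = (Y * V) * (N * D) by simp only [Matrix.mul_assoc],
    Matrix.trace_mul_comm (Y * V)]
  simp only [Matrix.transpose_mul, hV.eq, hY.eq, hD.eq, hN.eq, Matrix.mul_assoc]

/-- The part of `V • Y` outside the null space of `G` when `G' * Y = μ I` with `G'` near `G`. -/
theorem _root_.trace_mul_eq_of_conj_eq_zero {G G' V Y : Matrix (Fin m) (Fin m) ℝ} {μ : ℝ}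
    (hE : IsOrthonormalBasisMatrix E (matrixNullSpace G)) (hG : G.IsSymm)
    (hY : Y.IsSymm) (hV : Eᵀ * V * E = 0) (hGY : G' * Y = μ • (1 : Matrix (Fin m) (Fin m) ℝ)) :
    (V * Y).trace = μ * (V * pinv G).trace - (V * pinv G * ((G' - G) * Y)).trace
      - (V * (E * Eᵀ) * (((G' - G) * Y)ᵀ * pinv G)).trace := by
  have hH : G.IsHermitian := by
    rwa [Matrix.IsHermitian, Matrix.conjTranspose_eq_transpose_of_trivial]
  have hQ := hE.proj_eq hG
  have hN := (pinv_isSymm hG).eq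
  -- With Q = E Eᵀ, this solves G'Y = μI for (1 - Q)Y = G†G Y. Its transpose gives Y(1 - Q), and the
  -- remaining block QYQ is invisible to V because Eᵀ V E = 0 (`h4`).
  have h1 : pinv G * ((G' - G) * Y) = μ • pinv G - pinv G * G * Y := by
    rw [Matrix.sub_mul, hGY, Matrix.mul_sub, Matrix.mul_smul, Matrix.mul_one, Matrix.mul_assoc]
  have h2 : ((G' - G) * Y)ᵀ * pinv G = μ • pinv G - Y * (pinv G * G) := by
    have := congrArg Matrix.transpose h1
    rw [Matrix.transpose_mul, hN] at this
    rw [this, Matrix.transpose_sub, Matrix.transpose_smul, hN, Matrix.transpose_mul,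
      Matrix.transpose_mul, hN, hY.eq, hG.eq, mul_pinv_comm hG]
  have h3 : E * Eᵀ * pinv G = 0 := by
    rw [hQ, Matrix.sub_mul, (pinv_isMoorePenrose hH).mul_mul_right, Matrix.one_mul, sub_self]
  have h4 : (V * (E * Eᵀ) * (Y * (E * Eᵀ))).trace = 0 := by
    rw [← Matrix.mul_assoc, ← Matrix.mul_assoc, Matrix.trace_mul_comm]
    have : Eᵀ * (V * (E * Eᵀ) * Y * E) = (Eᵀ * V * E) * (Eᵀ * Y * E) := by
      simp only [Matrix.mul_assoc]
    rw [this, hV, Matrix.zero_mul, Matrix.trace_zero]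
  have h5 : pinv G * G = 1 - E * Eᵀ := by rw [hQ]; abel
  rw [Matrix.mul_assoc V (pinv G), h1, h2, Matrix.mul_sub (V * (E * Eᵀ)), Matrix.mul_smul,
    Matrix.mul_assoc V (E * Eᵀ) (pinv G), h3, Matrix.mul_zero, smul_zero, zero_sub, h5]
  simp only [Matrix.mul_sub, Matrix.sub_mul, Matrix.mul_one, Matrix.one_mul, Matrix.trace_sub,
    Matrix.trace_neg, Matrix.mul_smul, Matrix.trace_smul, smul_eq_mul]
  rw [h4, Matrix.mul_assoc V (E * Eᵀ) Y]
  ring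

/-- For u in 𝒰 the gradient of L at (x^k, Y_k, z^k) vanishes, and at (x*, Y_k, z^k) its component
along u is -ΔG(u) • Y_k. The scaled difference tends to the Hessian term. Expanding ΔG(u) • Y_k by
`trace_mul_eq_of_conj_eq_zero` leaves μ_k ΔG(u) • G† and two traces, each tending to half of the
sigma term. -/
theorem tendsto_mul_matInner_pinv
    (hE : IsOrthonormalBasisMatrix E (matrixNullSpace (P.G xstar)))
    (hB : ∀ k, P.IsBKKT (μ k) (x k) (Y k) (z k)) (hK : P.IsKKT xstar Y₀ z₀)
    (hx : Filter.Tendsto x l (𝓝 xstar)) (hY : Filter.Tendsto Y l (𝓝 Y₀))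
    (hz : Filter.Tendsto z l (𝓝 z₀))
    (hc : Filter.Tendsto (fun k => c k • (x k - xstar)) l (𝓝 e))
    {u : EuclideanSpace ℝ (Fin n)} (hu : u ∈ P.subspaceU E xstar) :
    Filter.Tendsto (fun k => c k * μ k * matInner (P.deltaG xstar u) (pinv (P.G xstar))) l
      (𝓝 (u.ofLp ⬝ᵥ ((P.hessL xstar Y₀ z₀ + P.sigmaTerm xstar Y₀) *ᵥ e.ofLp))) := by
  set V := P.deltaG xstar u with hVdef
  set N := pinv (P.G xstar) with hNdef
  set D := P.deltaG xstar e with hDdef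
  have hVs : Vᵀ = V := P.deltaG_isSymm _ _
  have hDs : Dᵀ = D := P.deltaG_isSymm _ _
  have hNs : Nᵀ = N := pinv_isSymm (P.G_symm xstar)
  have hYs : Y₀ᵀ = Y₀ := hK.Y_posSemidef.isSymm
  have h1 := ((continuous_const.dotProduct continuous_id).tendsto _ :
    Filter.Tendsto (fun w => u.ofLp ⬝ᵥ w) _ _).comp (P.tendsto_smul_gradL_sub hx hc hY hz)
  have h2 := tendsto_smul_G_sub_mul (P := P) hx hY hc
  have hcont : Continuous fun M : Matrix (Fin m) (Fin m) ℝ =>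
      (V * N * M).trace + (V * (E * Eᵀ) * (Mᵀ * N)).trace :=
    ((continuous_const.matrix_mul continuous_id).matrix_trace).add
      ((continuous_const.matrix_mul
        (continuous_id.matrix_transpose.matrix_mul continuous_const)).matrix_trace)
  have h3 := h1.add ((hcont.tendsto _).comp h2)
  have hlim : (V * N * (D * Y₀)).trace + (V * (E * Eᵀ) * ((D * Y₀)ᵀ * N)).trace
      = u.ofLp ⬝ᵥ (P.sigmaTerm xstar Y₀ *ᵥ e.ofLp) := by
    have e1 : (V * N * (D * Y₀)).trace = (Y₀ * (V * N * D)).trace := by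
      rw [← Matrix.mul_assoc, Matrix.trace_mul_comm]
    have e2 : (V * (E * Eᵀ) * ((D * Y₀)ᵀ * N)).trace = (Y₀ * (V * N * D)).trace := by
      rw [← trace_mul_mul_mul_of_isSymm hVs hYs hDs hNs, Matrix.transpose_mul, hYs, hDs,
        Matrix.mul_assoc V, Matrix.mul_assoc Y₀, ← Matrix.mul_assoc (E * Eᵀ), hK.proj_mul hE]
    rw [sigmaTerm_quadratic, e1, e2, matInner]
    ring
  have hfun : ∀ k, c k * μ k * matInner V N
      = u.ofLp ⬝ᵥ (c k • (P.gradL (x k) (Y k) (z k) - P.gradL xstar (Y k) (z k)))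
        + ((V * N * (c k • ((P.G (x k) - P.G xstar) * Y k))).trace
          + (V * (E * Eᵀ) * ((c k • ((P.G (x k) - P.G xstar) * Y k))ᵀ * N)).trace) := by
    intro k
    have a1 := trace_mul_eq_of_conj_eq_zero hE (P.G_symm xstar)
      (hB k).Y_posDef.posSemidef.isSymm hu.1 (hB k).G_mul_Y
    have a2 := P.gradL_dotProduct xstar u (Y k) (z k)
    rw [(hK.mem_criticalCone hE hu).1, hu.2, dotProduct_zero, add_zero, zero_sub, matInner, a1]
      at a2
    rw [(hB k).stationary, zero_sub, smul_neg, dotProduct_neg, dotProduct_smul,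
      dotProduct_comm, a2]
    simp only [Matrix.transpose_smul, Matrix.mul_smul, Matrix.smul_mul, Matrix.trace_smul,
      smul_eq_mul, matInner]
    ring
  simp only [hfun]
  rw [Matrix.add_mulVec, dotProduct_add, ← hlim]
  exact h3

/-- If `μ` tends to zero faster than the distances `1 / c`, the rescaled points tend to zero. -/
theorem limit_eq_zero_of_mul_tendsto_zero [l.NeBot]
    (hE : IsOrthonormalBasisMatrix E (matrixNullSpace (P.G xstar)))
    (hSC : P.StrictComplementarity xstar) (hSSOSC : P.SSOSC E xstar)
    (hB : ∀ k, P.IsBKKT (μ k) (x k) (Y k) (z k)) (hK : P.IsKKT xstar Y₀ z₀)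
    (hx : Filter.Tendsto x l (𝓝 xstar)) (hY : Filter.Tendsto Y l (𝓝 Y₀))
    (hz : Filter.Tendsto z l (𝓝 z₀)) (hc0 : ∀ k, 0 ≤ c k)
    (hc : Filter.Tendsto (fun k => c k • (x k - xstar)) l (𝓝 e))
    (hν : Filter.Tendsto (fun k => c k * μ k) l (𝓝 0)) : e = 0 := by
  obtain ⟨Y₁, z₁, hK₁, hpos⟩ := hSC
  replace hK₁ : P.IsKKT xstar Y₁ z₁ := hK₁
  have hh := P.gradH_transpose_mulVec_eq_zero hx hc (fun k => (hB k).h_eq_zero) hK.h_eq_zero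
  have h0 := conj_deltaG_mul_conj_eq hE hB hK hx hY hc hν
  have hpsd : (Eᵀ * P.deltaG xstar e * E).PosSemidef := by
    have hcont : Continuous fun M : Matrix (Fin m) (Fin m) ℝ => Eᵀ * M * E :=
      (continuous_const.matrix_mul continuous_id).matrix_mul continuous_const
    refine Matrix.PosSemidef.of_tendsto (fun k => ?_)
      ((hcont.tendsto _).comp (P.tendsto_smul_G_sub hx hc))
    simp only [Function.comp_apply]
    rw [Matrix.mul_smul, Matrix.smul_mul, Matrix.mul_sub, Matrix.sub_mul,
      Matrix.mul_assoc _ (P.G xstar), hE.mul_eq_zero, Matrix.mul_zero, sub_zero]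
    exact ((hB k).G_posDef.posSemidef.transpose_mul_mul_same E).smul (hc0 k)
  -- Y₀ need not be strictly complementary, but ΔG(e) • Y is constant on Λ(x*), so its zero value
  -- passes from Y₀ to Y₁.
  have hF : matInner (P.deltaG xstar e) Y₁ = 0 := by
    rw [← hK₁.gradF_dotProduct hh, hK.gradF_dotProduct hh, hK.matInner_eq hE, h0, zero_smul,
      Matrix.trace_zero]
  rw [hK₁.matInner_eq hE] at hF
  have hY₁ := IsKKT.conj_posDef hE hpos
  have hEE : Eᵀ * P.deltaG xstar e * E = 0 :=
    hY₁.eq_zero_of_mul_eq_zero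
      (hY₁.posSemidef.mul_eq_zero_of_trace hpsd (by rwa [Matrix.trace_mul_comm]))
  have hu : e ∈ P.subspaceU E xstar := ⟨hEE, hh⟩
  -- Now e itself may serve as test direction.
  have h2 := tendsto_mul_matInner_pinv hE hB hK hx hY hz hc hu
  have h3 := tendsto_nhds_unique h2 (hν.mul_const _)
  rw [zero_mul] at h3
  by_contra hne
  exact (hSSOSC Y₀ z₀ hK e (hK.mem_criticalCone hE hu) hne).ne' h3

end Limits

end NSDP

namespace NSDP

variable {n m s q p : ℕ} {P : NSDP n m s} {xstar : EuclideanSpace ℝ (Fin n)}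
  {E : Matrix (Fin m) (Fin q) ℝ} {U : Matrix (Fin n) (Fin p) ℝ}
  {Y₀ : Matrix (Fin m) (Fin m) ℝ} {z₀ : EuclideanSpace ℝ (Fin s)}

/-! ### The tangent system -/

theorem adjG_sub (x : EuclideanSpace ℝ (Fin n)) (Y Y' : Matrix (Fin m) (Fin m) ℝ) :
    P.adjG x (Y - Y') = P.adjG x Y - P.adjG x Y' := by
  funext i
  simp [adjG, matInner, Matrix.mul_sub]

theorem exists_solvesTangentSystem
    (hE : IsOrthonormalBasisMatrix E (matrixNullSpace (P.G xstar)))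
    (hU : IsOrthonormalBasisMatrix U (P.subspaceU E xstar))
    (hK : P.IsKKT xstar Y₀ z₀) {d : EuclideanSpace ℝ (Fin n)}
    (hd : (Eᵀ * P.deltaG xstar d * E) * (Eᵀ * Y₀ * E) = 1)
    (hh : (P.gradH xstar)ᵀ *ᵥ d.ofLp = 0)
    (hL : ∀ u ∈ P.subspaceU E xstar,
      u.ofLp ⬝ᵥ ((P.hessL xstar Y₀ z₀ + P.sigmaTerm xstar Y₀) *ᵥ d.ofLp)
        = matInner (P.deltaG xstar u) (pinv (P.G xstar))) :
    ∃ ΔY, P.SolvesTangentSystem U xstar Y₀ z₀ d ΔY := by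
  have hGs := P.G_symm xstar
  have hNs := pinv_isSymm hGs
  have hYs := hK.Y_posSemidef.isSymm
  have hDs := P.deltaG_isSymm xstar d
  have hQ := hE.proj_eq hGs
  have hNG : pinv (P.G xstar) * P.G xstar = 1 - E * Eᵀ := by rw [hQ]; abel
  have hGN : P.G xstar * pinv (P.G xstar) = 1 - E * Eᵀ := by rw [mul_pinv_comm hGs, hNG]
  have hYG : Y₀ * P.G xstar = 0 := by
    have := congrArg Matrix.transpose hK.G_mul_eq_zero
    rwa [Matrix.transpose_mul, hYs.eq, hGs.eq, Matrix.transpose_zero] at this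
  -- The second equation is solved block by block: G† on the range of G, the two products in the
  -- mixed blocks. The null-space block of ΔY is unconstrained there and is taken to be zero.
  refine ⟨pinv (P.G xstar) - pinv (P.G xstar) * P.deltaG xstar d * Y₀
    - Y₀ * P.deltaG xstar d * pinv (P.G xstar), ?_, ?_, ?_, hh⟩
  · rw [Matrix.IsSymm]
    simp only [Matrix.transpose_sub, Matrix.transpose_mul, hNs.eq, hYs.eq, hDs.eq,
      Matrix.mul_assoc]
    abel
  · funext a
    have hu := hU.col_mem a
    have hLu := hL _ hu
    have hadj := fun M => P.adjG_dotProduct xstar (WithLp.toLp 2 (U.col a)) M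
    have hmul : ∀ w : Fin n → ℝ, (Uᵀ *ᵥ w) a = U.col a ⬝ᵥ w := fun w => rfl
    rw [Matrix.add_mulVec, dotProduct_add, sigmaTerm_quadratic] at hLu
    rw [hmul, dotProduct_sub, dotProduct_comm _ (P.adjG _ _), hadj]
    simp only [matInner, Matrix.mul_sub, Matrix.trace_sub] at hLu ⊢
    rw [trace_mul_mul_mul_of_isSymm (P.deltaG_isSymm _ _) hYs hDs hNs,
      ← Matrix.mul_assoc _ _ Y₀, ← Matrix.mul_assoc, Matrix.trace_mul_comm _ Y₀,
      Pi.zero_apply, ← hLu]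
    ring
  -- The hypothesis `hd` lifted from the null space to the full matrix space.
  · have hQDY : E * Eᵀ * P.deltaG xstar d * Y₀ = E * Eᵀ := by
      calc E * Eᵀ * P.deltaG xstar d * Y₀
          = E * Eᵀ * P.deltaG xstar d * (E * (Eᵀ * Y₀ * E) * Eᵀ) := by rw [← hK.eq_conj hE]
        _ = E * ((Eᵀ * P.deltaG xstar d * E) * (Eᵀ * Y₀ * E)) * Eᵀ := by
          simp only [Matrix.mul_assoc]
        _ = E * Eᵀ := by rw [hd, Matrix.mul_one]
    have hYDQ : Y₀ * P.deltaG xstar d * (E * Eᵀ) = E * Eᵀ := by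
      have := congrArg Matrix.transpose hQDY
      simpa only [Matrix.transpose_mul, hYs.eq, hDs.eq, Matrix.transpose_transpose,
        Matrix.mul_assoc] using this
    have h1 : P.G xstar * (pinv (P.G xstar) - pinv (P.G xstar) * P.deltaG xstar d * Y₀
        - Y₀ * P.deltaG xstar d * pinv (P.G xstar)) = 1 - P.deltaG xstar d * Y₀ := by
      rw [Matrix.mul_sub, Matrix.mul_sub, Matrix.mul_assoc, ← Matrix.mul_assoc (P.G xstar),
        hGN, Matrix.mul_assoc Y₀, ← Matrix.mul_assoc (P.G xstar), hK.G_mul_eq_zero,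
        Matrix.zero_mul, Matrix.sub_mul, Matrix.one_mul, ← Matrix.mul_assoc, hQDY]
      abel
    have h2 : (pinv (P.G xstar) - pinv (P.G xstar) * P.deltaG xstar d * Y₀
        - Y₀ * P.deltaG xstar d * pinv (P.G xstar)) * P.G xstar
          = 1 - Y₀ * P.deltaG xstar d := by
      rw [Matrix.sub_mul, Matrix.sub_mul, Matrix.mul_assoc _ Y₀, hYG, Matrix.mul_zero,
        Matrix.mul_assoc _ (pinv (P.G xstar)), hNG, Matrix.mul_sub, Matrix.mul_one, hYDQ]
      abel
    rw [symMul, symMul, h1, h2, two_smul]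
    abel

/-- The second equation is split by E Eᵀ and G†G. Its null block forces Eᵀ ΔG(d) E = 0, so d ∈ 𝒰;
the other blocks determine W except for its null block, which is orthogonal to ΔG(d). Hence ΔG(d) •
W is minus the sigma term, and testing the first equation with d makes the quadratic form vanish. -/
theorem eq_zero_of_homogeneous_tangentSystem
    (hE : IsOrthonormalBasisMatrix E (matrixNullSpace (P.G xstar)))
    (hU : IsOrthonormalBasisMatrix U (P.subspaceU E xstar))
    (hSSOSC : P.SSOSC E xstar) (hK : P.IsKKT xstar Y₀ z₀)
    (hpos : (Eᵀ * Y₀ * E).PosDef) {d : EuclideanSpace ℝ (Fin n)}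
    {W : Matrix (Fin m) (Fin m) ℝ} (hW : W.IsSymm)
    (hL : Uᵀ *ᵥ (P.hessL xstar Y₀ z₀ *ᵥ d.ofLp - P.adjG xstar W) = 0)
    (hG : symMul (P.G xstar) W + symMul Y₀ (P.deltaG xstar d) = 0)
    (hh : (P.gradH xstar)ᵀ *ᵥ d.ofLp = 0) : d = 0 := by
  set G := P.G xstar with hGdef
  set N := pinv G with hNdef
  set D := P.deltaG xstar d with hDdef
  have hGs : G.IsSymm := P.G_symm xstar
  have hH : G.IsHermitian := by
    rwa [Matrix.IsHermitian, Matrix.conjTranspose_eq_transpose_of_trivial]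
  have hNs : N.IsSymm := pinv_isSymm hGs
  have hYs := hK.Y_posSemidef.isSymm
  have hDs : D.IsSymm := P.deltaG_isSymm xstar d
  have hNG : N * G = 1 - E * Eᵀ := by rw [hE.proj_eq hGs]; abel
  have hGN : G * N = 1 - E * Eᵀ := by rw [mul_pinv_comm hGs, hNG]
  have hGE : G * E = 0 := hE.mul_eq_zero
  have hEG : Eᵀ * G = 0 := by
    have := congrArg Matrix.transpose hGE
    rwa [Matrix.transpose_mul, hGs.eq, Matrix.transpose_zero] at this
  have hGY : G * Y₀ = 0 := hK.G_mul_eq_zero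
  have hYG : Y₀ * G = 0 := by
    have := congrArg Matrix.transpose hGY
    rwa [Matrix.transpose_mul, hYs.eq, hGs.eq, Matrix.transpose_zero] at this
  have hNY : N * Y₀ = 0 := by
    calc N * Y₀ = N * (G * N) * Y₀ := by
          rw [← Matrix.mul_assoc, (pinv_isMoorePenrose hH).mul_mul_right]
      _ = N * (N * (G * Y₀)) := by rw [hGN, ← hNG]; simp only [Matrix.mul_assoc]
      _ = 0 := by rw [hGY, Matrix.mul_zero, Matrix.mul_zero]
  have hYE : E * (Eᵀ * Y₀) = Y₀ := by rw [← Matrix.mul_assoc]; exact hK.proj_mul hE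
  have hYE' : Y₀ * (E * Eᵀ) = Y₀ := hK.mul_proj hE
  have hEE : Eᵀ * D * E = 0 := by
    refine hpos.eq_zero_of_mul_eq_zero
      (hpos.posSemidef.mul_eq_zero_of_symMul_eq_zero ?_ ?_)
    · rw [Matrix.IsSymm]
      simp only [Matrix.transpose_mul, hDs.eq, Matrix.transpose_transpose, Matrix.mul_assoc]
    · have h := congrArg (fun M => Eᵀ * M * E) hG
      simp only [symMul, Matrix.mul_add, Matrix.add_mul, Matrix.mul_zero, Matrix.zero_mul] at h
      rw [← Matrix.mul_assoc, hEG, Matrix.zero_mul, Matrix.zero_mul, Matrix.mul_assoc Eᵀ (W * G),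
        Matrix.mul_assoc W, hGE, Matrix.mul_zero, Matrix.mul_zero, zero_add, zero_add] at h
      rw [symMul, ← h]
      congr 1
      · calc Eᵀ * Y₀ * E * (Eᵀ * D * E) = Eᵀ * (Y₀ * (E * Eᵀ)) * D * E := by
              simp only [Matrix.mul_assoc]
          _ = _ := by rw [hYE']; simp only [Matrix.mul_assoc]
      · calc Eᵀ * D * E * (Eᵀ * Y₀ * E) = Eᵀ * D * (E * (Eᵀ * Y₀)) * E := by
              simp only [Matrix.mul_assoc]
          _ = _ := by rw [hYE]; simp only [Matrix.mul_assoc]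
  have hu : d ∈ P.subspaceU E xstar := ⟨hEE, hh⟩
  -- The terms in Y₀ drop out of the range block, leaving a Lyapunov equation for the semidefinite
  -- G.
  have hWB : N * G * W * (G * N) = 0 := by
    have h1 : symMul G (N * G * W * (G * N)) = 0 := by
      have h := congrArg (fun M => N * G * M * (G * N)) hG
      simp only [symMul, Matrix.mul_add, Matrix.add_mul, Matrix.mul_zero, Matrix.zero_mul] at h
      have e1 : N * G * (Y₀ * D) * (G * N) = 0 := by
        rw [Matrix.mul_assoc N, ← Matrix.mul_assoc G, hGY]; simp
      have e2 : N * G * (D * Y₀) * (G * N) = 0 := by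
        rw [Matrix.mul_assoc, ← Matrix.mul_assoc _ G, Matrix.mul_assoc D, hYG]; simp
      rw [e1, e2, add_zero, add_zero] at h
      rw [symMul, ← h]
      congr 1
      · calc G * (N * G * W * (G * N)) = (G * N) * (G * W) * (G * N) := by
              simp only [Matrix.mul_assoc]
          _ = _ := by rw [hGN, ← hNG]
      · rw [Matrix.mul_assoc _ (G * N) G, Matrix.mul_assoc G N G, hNG, ← hGN]
        simp only [Matrix.mul_assoc]
    have hs : (N * G * W * (G * N)).IsSymm := by
      rw [Matrix.IsSymm]
      simp only [Matrix.transpose_mul, hNs.eq, hGs.eq, hW.eq, Matrix.mul_assoc]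
    have h2 := hK.G_posSemidef.mul_eq_zero_of_symMul_eq_zero hs h1
    calc N * G * W * (G * N) = (N * G * N) * G * W * (G * N) := by
          rw [(pinv_isMoorePenrose hH).mul_mul_right]
      _ = N * (G * (N * G * W * (G * N))) := by simp only [Matrix.mul_assoc]
      _ = 0 := by rw [hGdef, h2, Matrix.mul_zero]
  have hWR : N * G * W * (E * Eᵀ) = - (N * D * Y₀) := by
    have h := congrArg (fun M => N * M * (E * Eᵀ)) hG
    simp only [symMul, Matrix.mul_add, Matrix.add_mul, Matrix.mul_zero, Matrix.zero_mul] at h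
    have e1 : N * (W * G) * (E * Eᵀ) = 0 := by
      rw [Matrix.mul_assoc, ← Matrix.mul_assoc (W * G), Matrix.mul_assoc W, hGE]; simp
    have e2 : N * (Y₀ * D) * (E * Eᵀ) = 0 := by
      rw [← Matrix.mul_assoc N, hNY]; simp
    have e3 : N * (D * Y₀) * (E * Eᵀ) = N * D * Y₀ := by
      rw [← Matrix.mul_assoc N, Matrix.mul_assoc _ Y₀, hYE']
    rw [e1, e2, e3, add_zero, zero_add] at h
    rw [Matrix.mul_assoc N G W]
    exact eq_neg_of_add_eq_zero_left h
  have hWL : E * Eᵀ * W * (G * N) = - (Y₀ * D * N) := by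
    have := congrArg Matrix.transpose hWR
    simpa only [Matrix.transpose_mul, Matrix.transpose_neg, hNs.eq, hGs.eq, hW.eq, hYs.eq,
      hDs.eq, Matrix.transpose_transpose, Matrix.mul_assoc] using this
  have hdec : W = E * Eᵀ * W * (E * Eᵀ) - N * D * Y₀ - Y₀ * D * N := by
    have h1 : W = (N * G + E * Eᵀ) * W * (G * N + E * Eᵀ) := by
      rw [hNG, hGN, sub_add_cancel, Matrix.one_mul, Matrix.mul_one]
    rw [Matrix.add_mul, Matrix.mul_add, Matrix.add_mul, Matrix.add_mul, hWB, hWR, hWL] at h1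
    refine h1.trans ?_
    abel
  have htr : matInner D W = - (2 * matInner Y₀ (D * N * D)) := by
    have e1 : (D * (E * Eᵀ * W * (E * Eᵀ))).trace = 0 := by
      rw [← Matrix.mul_assoc, Matrix.trace_mul_comm, Matrix.mul_assoc E]
      have : Eᵀ * (D * (E * Eᵀ * W)) = (Eᵀ * D * E) * (Eᵀ * W) := by
        simp only [Matrix.mul_assoc]
      rw [this, hEE, Matrix.zero_mul, Matrix.mul_zero, Matrix.trace_zero]
    rw [matInner, hdec, Matrix.mul_sub, Matrix.mul_sub, Matrix.trace_sub, Matrix.trace_sub, e1,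
      trace_mul_mul_mul_of_isSymm hDs hYs hDs hNs, ← Matrix.mul_assoc D (N * D),
      Matrix.trace_mul_comm _ Y₀, ← Matrix.mul_assoc D N, matInner]
    ring
  by_contra hne
  refine (hSSOSC Y₀ z₀ hK d (hK.mem_criticalCone hE hu) hne).ne' ?_
  obtain ⟨c, hc⟩ := hU.exists_mulVec hu
  have h0 : d.ofLp ⬝ᵥ (P.hessL xstar Y₀ z₀ *ᵥ d.ofLp - P.adjG xstar W) = 0 := by
    have h1 : ∀ w, d.ofLp ⬝ᵥ w = c ⬝ᵥ (Uᵀ *ᵥ w) := fun w => by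
      rw [hc, Matrix.dotProduct_mulVec, Matrix.vecMul_transpose]
    rw [h1, hL, dotProduct_zero]
  rw [dotProduct_sub, dotProduct_comm _ (P.adjG _ _), adjG_dotProduct, htr] at h0
  rw [Matrix.add_mulVec, dotProduct_add, sigmaTerm_quadratic]
  linarith

/-! ### The analytic center -/

theorem IsKKT.eq_of_conj_eq {Y₁ : Matrix (Fin m) (Fin m) ℝ} {z₁ : EuclideanSpace ℝ (Fin s)}
    (hE : IsOrthonormalBasisMatrix E (matrixNullSpace (P.G xstar))) (hMFCQ : P.MFCQ xstar)
    (hK : P.IsKKT xstar Y₀ z₀) (hK₁ : P.IsKKT xstar Y₁ z₁)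
    (h : Eᵀ * Y₁ * E = Eᵀ * Y₀ * E) : Y₁ = Y₀ ∧ z₁ = z₀ := by
  have hY : Y₁ = Y₀ := by rw [hK.eq_conj hE, hK₁.eq_conj hE, h]
  refine ⟨hY, ?_⟩
  have h1 := hK₁.stationary.trans hK.stationary.symm
  rw [hY, gradL, gradL, add_right_inj] at h1
  exact WithLp.ofLp_injective 2 (Matrix.mulVec_injective_iff.mpr hMFCQ.full_column_rank h1)

/-- A multiplier whose reduced inverse is `Eᵀ ΔG(x; d) E` for a direction `d` tangent to the
equality constraints has the largest reduced determinant, and is the only one that has. -/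
theorem IsKKT.eq_of_det_le {d : EuclideanSpace ℝ (Fin n)} {Y₁ : Matrix (Fin m) (Fin m) ℝ}
    {z₁ : EuclideanSpace ℝ (Fin s)}
    (hE : IsOrthonormalBasisMatrix E (matrixNullSpace (P.G xstar))) (hMFCQ : P.MFCQ xstar)
    (hK : P.IsKKT xstar Y₀ z₀) (hK₁ : P.IsKKT xstar Y₁ z₁)
    (hd : (Eᵀ * P.deltaG xstar d * E) * (Eᵀ * Y₀ * E) = 1)
    (hh : (P.gradH xstar)ᵀ *ᵥ d.ofLp = 0)
    (hdet : (Eᵀ * Y₀ * E).det ≤ (Eᵀ * Y₁ * E).det) : Y₁ = Y₀ ∧ z₁ = z₀ := by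
  refine hK.eq_of_conj_eq hE hMFCQ hK₁ ?_
  have hT := hK.Y_posSemidef.transpose_mul_mul_same E
  have hS : (Eᵀ * P.deltaG xstar d * E).PosSemidef := by
    rw [← Matrix.inv_eq_left_inv hd]
    exact hT.inv
  refine hS.eq_of_trace_of_det_le hd (hK₁.Y_posSemidef.transpose_mul_mul_same E) ?_ hdet
  -- The trace is ΔG(d) • Y₁, which equals ΔG(d) • Y₀ = tr I = q.
  rw [← hK₁.matInner_eq hE, ← hK₁.gradF_dotProduct hh, hK.gradF_dotProduct hh, hK.matInner_eq hE,
    hd, Matrix.trace_one, Fintype.card_fin]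

theorem IsKKT.isAnalyticCenter {d : EuclideanSpace ℝ (Fin n)}
    (hE : IsOrthonormalBasisMatrix E (matrixNullSpace (P.G xstar))) (hMFCQ : P.MFCQ xstar)
    (hK : P.IsKKT xstar Y₀ z₀) (hd : (Eᵀ * P.deltaG xstar d * E) * (Eᵀ * Y₀ * E) = 1)
    (hh : (P.gradH xstar)ᵀ *ᵥ d.ofLp = 0) : P.IsAnalyticCenter E xstar Y₀ z₀ := by
  refine ⟨hK, fun Y' z' hK' => ?_⟩
  rcases le_total (Eᵀ * Y₀ * E).det (Eᵀ * Y' * E).det with h | h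
  · rw [show Y' = Y₀ from (hK.eq_of_det_le hE hMFCQ hK' hd hh h).1]
  · exact EReal.neg_le_neg_iff.mpr (ENNReal.log_monotone (ENNReal.ofReal_le_ofReal h))

theorem IsAnalyticCenter.eq {d : EuclideanSpace ℝ (Fin n)} {Y₁ : Matrix (Fin m) (Fin m) ℝ}
    {z₁ : EuclideanSpace ℝ (Fin s)} (hA : P.IsAnalyticCenter E xstar Y₁ z₁)
    (hE : IsOrthonormalBasisMatrix E (matrixNullSpace (P.G xstar))) (hMFCQ : P.MFCQ xstar)
    (hK : P.IsKKT xstar Y₀ z₀) (hd : (Eᵀ * P.deltaG xstar d * E) * (Eᵀ * Y₀ * E) = 1)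
    (hh : (P.gradH xstar)ᵀ *ᵥ d.ofLp = 0) : Y₁ = Y₀ ∧ z₁ = z₀ := by
  have hK₁ : P.IsKKT xstar Y₁ z₁ := hA.1
  refine hK.eq_of_det_le hE hMFCQ hK₁ hd hh ?_
  have h := ENNReal.log_strictMono.le_iff_le.mp (EReal.neg_le_neg_iff.mp (hA.2 Y₀ z₀ hK))
  -- `ENNReal.ofReal` clips negative values, so the larger determinant must be known to be
  -- nonnegative.
  exact (ENNReal.ofReal_le_ofReal_iff
    (hK₁.Y_posSemidef.transpose_mul_mul_same E).det_nonneg).mp h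

end NSDP

namespace NSDP

variable {n m s q p : ℕ} {P : NSDP n m s} {xstar : EuclideanSpace ℝ (Fin n)}
  {E : Matrix (Fin m) (Fin q) ℝ} {U : Matrix (Fin n) (Fin p) ℝ}

/-! ### Convergence along ultrafilters -/

/-- Working along an ultrafilter avoids successive extraction of subsequences. -/
theorem _root_.Ultrafilter.exists_tendsto_of_norm_le_one {ι X : Type*} [NormedAddCommGroup X]
    [ProperSpace X] (l : Ultrafilter ι) {w : ι → X} (hw : ∀ k, ‖w k‖ ≤ 1) :
    ∃ w₀, Filter.Tendsto w l (𝓝 w₀) := by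
  obtain ⟨w₀, -, h⟩ := (isCompact_closedBall (0 : X) 1).ultrafilter_le_nhds (l.map w) (by
    rw [Filter.le_principal_iff, Ultrafilter.coe_map]
    exact Filter.mem_map.mpr (Filter.univ_mem' fun k => mem_closedBall_zero_iff.mpr (hw k)))
  exact ⟨w₀, h⟩

variable {ι : Type*} {x : ι → EuclideanSpace ℝ (Fin n)} {μ : ι → ℝ}
  {Y : ι → Matrix (Fin m) (Fin m) ℝ} {z : ι → EuclideanSpace ℝ (Fin s)}

theorem exists_tendsto_multipliers (l : Ultrafilter ι) (hMFCQ : P.MFCQ xstar)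
    (hB : ∀ k, P.IsBKKT (μ k) (x k) (Y k) (z k))
    (hμ : Filter.Tendsto μ l (𝓝 0)) (hx : Filter.Tendsto x l (𝓝 xstar)) :
    ∃ Y₀ z₀, Filter.Tendsto Y l (𝓝 Y₀) ∧ Filter.Tendsto z l (𝓝 z₀) := by
  let w : ι → (Fin m → Fin m → ℝ) × EuclideanSpace ℝ (Fin s) := fun k => (Y k, z k)
  -- With this scaling both t and t • w are bounded, and ‖t • w‖ = 1 - t. If t tends to zero, the
  -- limit of t • w has norm 1 but solves the homogeneous system excluded by MFCQ; otherwise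
  -- division by the limit of t recovers convergence of w.
  let t : ι → ℝ := fun k => (‖w k‖ + 1)⁻¹
  have ht0 : ∀ k, 0 < t k := fun k => inv_pos.mpr (by positivity)
  have htw : ∀ k, ‖t k • w k‖ = 1 - t k := by
    intro k
    rw [norm_smul, Real.norm_eq_abs, abs_of_pos (ht0 k)]
    have : ‖w k‖ + 1 ≠ 0 := by positivity
    simp only [t]
    field_simp
    ring
  obtain ⟨V₀, ζ₀, hv₀⟩ : ∃ (V₀ : Matrix (Fin m) (Fin m) ℝ) (ζ₀ : EuclideanSpace ℝ (Fin s)),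
      Filter.Tendsto (fun k => t k • w k) l (𝓝 (V₀, ζ₀)) := by
    obtain ⟨v₀, hv₀⟩ := l.exists_tendsto_of_norm_le_one (w := fun k => t k • w k)
      fun k => by rw [htw]; linarith [ht0 k]
    exact ⟨v₀.1, v₀.2, hv₀⟩
  obtain ⟨t₀, ht₀⟩ := l.exists_tendsto_of_norm_le_one (w := t) fun k => by
    rw [Real.norm_eq_abs, abs_of_pos (ht0 k)]
    linarith [htw k, norm_nonneg (t k • w k)]
  have hV : Filter.Tendsto (fun k => t k • Y k) l (𝓝 V₀) :=
    (continuous_fst.tendsto (V₀, ζ₀)).comp hv₀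
  have hζ : Filter.Tendsto (fun k => t k • z k) l (𝓝 ζ₀) := 
    (continuous_snd.tendsto (V₀, ζ₀)).comp hv₀
  have hne : t₀ ≠ 0 := by
    rintro rfl
    have hpsd : V₀.PosSemidef :=
      Matrix.PosSemidef.of_tendsto (fun k => (hB k).Y_posDef.posSemidef.smul (ht0 k).le) hV
    have hGV : P.G xstar * V₀ = 0 := by
      have h1 := ((continuous_fst.matrix_mul continuous_snd).tendsto
        (P.G xstar, V₀)).comp ((P.tendsto_G hx).prodMk_nhds hV)
      have h2 : Filter.Tendsto (fun k => P.G (x k) * (t k • Y k)) l (𝓝 0) := by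
        simp only [Matrix.mul_smul, fun k => (hB k).G_mul_Y, smul_smul]
        simpa using (ht₀.mul hμ).smul_const (1 : Matrix (Fin m) (Fin m) ℝ)
      exact tendsto_nhds_unique h1 h2
    have hst : - P.adjG xstar V₀ + P.gradH xstar *ᵥ ζ₀.ofLp = 0 := by
      have h1 := (ht₀.smul (P.tendsto_gradF hx)).add (P.tendsto_neg_adjG_add_gradH hx hV hζ)
      rw [zero_smul, zero_add] at h1
      have h2 : ∀ k, t k • P.gradF (x k) + (- P.adjG (x k) (t k • Y k)
          + P.gradH (x k) *ᵥ (t k • z k).ofLp) = 0 := by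
        intro k
        have h3 : P.adjG (x k) (t k • Y k) = t k • P.adjG (x k) (Y k) := by
          funext i
          simp [adjG, matInner]
        have h4 := congrArg (fun v => t k • v) (hB k).stationary
        simp only [gradL, smul_add, smul_sub, smul_zero] at h4
        rw [h3, WithLp.ofLp_smul, Matrix.mulVec_smul, ← h4]
        abel
      simp only [h2] at h1
      exact (tendsto_nhds_unique h1 tendsto_const_nhds)
    obtain ⟨hz1, hz2⟩ := hMFCQ.eq_zero hpsd hGV hst
    have h1 : Filter.Tendsto (fun k => ‖t k • w k‖) l (𝓝 0) := by
      have := hv₀.norm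
      rw [hz1, hz2] at this
      exact norm_zero (E := (Fin m → Fin m → ℝ) × EuclideanSpace ℝ (Fin s)) ▸ this
    simp only [htw] at h1
    have h2 := tendsto_nhds_unique h1 (ht₀.const_sub 1)
    norm_num at h2
  refine ⟨t₀⁻¹ • V₀, t₀⁻¹ • ζ₀, ?_, ?_⟩
  · refine ((ht₀.inv₀ hne).smul hV).congr fun k => ?_
    rw [smul_smul, inv_mul_cancel₀ (ht0 k).ne', one_smul]
  · refine ((ht₀.inv₀ hne).smul hζ).congr fun k => ?_
    rw [smul_smul, inv_mul_cancel₀ (ht0 k).ne', one_smul]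

/-- Scaling by 1/(‖x - x*‖ + μ) first gives limits by compactness. Only after the limit ν of the
scaled μ is known to be nonzero may the scaling be changed to 1/μ. -/
theorem exists_tendsto_of_isBKKT (l : Ultrafilter ι)
    (hE : IsOrthonormalBasisMatrix E (matrixNullSpace (P.G xstar)))
    (hU : IsOrthonormalBasisMatrix U (P.subspaceU E xstar))
    (hSC : P.StrictComplementarity xstar) (hSSOSC : P.SSOSC E xstar) (hMFCQ : P.MFCQ xstar)
    (hB : ∀ k, P.IsBKKT (μ k) (x k) (Y k) (z k))
    (hμ : Filter.Tendsto μ l (𝓝 0)) (hx : Filter.Tendsto x l (𝓝 xstar)) :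
    ∃ Y₀ z₀ d, P.IsKKT xstar Y₀ z₀ ∧ Filter.Tendsto Y l (𝓝 Y₀) ∧ Filter.Tendsto z l (𝓝 z₀) ∧
      Filter.Tendsto (fun k => (μ k)⁻¹ • (x k - xstar)) l (𝓝 d) ∧
      (Eᵀ * P.deltaG xstar d * E) * (Eᵀ * Y₀ * E) = 1 ∧ (P.gradH xstar)ᵀ *ᵥ d.ofLp = 0 ∧
      ∃ ΔY, P.SolvesTangentSystem U xstar Y₀ z₀ d ΔY := by
  obtain ⟨Y₀, z₀, hY, hz⟩ := exists_tendsto_multipliers l hMFCQ hB hμ hx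
  have hK := isKKT_of_tendsto hMFCQ hB hμ hx hY hz
  have hμ0 := fun k => (hB k).mu_pos
  let c : ι → ℝ := fun k => (‖x k - xstar‖ + μ k)⁻¹
  have hpos : ∀ k, 0 < ‖x k - xstar‖ + μ k := fun k =>
    add_pos_of_nonneg_of_pos (norm_nonneg _) (hμ0 k)
  have hc0 : ∀ k, 0 < c k := fun k => inv_pos.mpr (hpos k)
  have hsum : ∀ k, ‖c k • (x k - xstar)‖ + c k * μ k = 1 := by
    intro k
    rw [norm_smul, Real.norm_eq_abs, abs_of_pos (hc0 k), ← mul_add]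
    exact inv_mul_cancel₀ (hpos k).ne'
  have hcμ : ∀ k, 0 < c k * μ k := fun k => mul_pos (hc0 k) (hμ0 k)
  obtain ⟨e, he⟩ := l.exists_tendsto_of_norm_le_one (w := fun k => c k • (x k - xstar))
    fun k => by linarith [hsum k, hcμ k]
  obtain ⟨ν, hν⟩ := l.exists_tendsto_of_norm_le_one (w := fun k => c k * μ k) fun k => by
    rw [Real.norm_eq_abs, abs_of_pos (hcμ k)]
    linarith [hsum k, norm_nonneg (c k • (x k - xstar))]
  -- The norm of the scaled displacement and the scaled μ add up to 1, so they cannot both tend to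
  -- zero.
  have hν0 : ν ≠ 0 := by
    rintro rfl
    have he0 := limit_eq_zero_of_mul_tendsto_zero hE hSC hSSOSC hB hK hx hY hz
      (fun k => (hc0 k).le) he hν
    have h1 := he.norm.add hν
    simp only [hsum, he0, norm_zero, add_zero] at h1
    exact one_ne_zero (tendsto_nhds_unique tendsto_const_nhds h1)
  have hd : Filter.Tendsto (fun k => (μ k)⁻¹ • (x k - xstar)) l (𝓝 (ν⁻¹ • e)) := by
    have h1 := (hν.inv₀ hν0).smul he
    have h2 : (fun k => (c k * μ k)⁻¹ • c k • (x k - xstar))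
        = fun k => (μ k)⁻¹ • (x k - xstar) := by
      funext k
      rw [smul_smul, mul_inv_rev, mul_assoc, inv_mul_cancel₀ (hc0 k).ne', mul_one]
    rwa [h2] at h1
  have hone : Filter.Tendsto (fun k => (μ k)⁻¹ * μ k) l (𝓝 1) := by
    simp only [fun k => inv_mul_cancel₀ (hμ0 k).ne']
    exact tendsto_const_nhds
  have hh := P.gradH_transpose_mulVec_eq_zero hx hd (fun k => (hB k).h_eq_zero) hK.h_eq_zero
  have hEE := conj_deltaG_mul_conj_eq hE hB hK hx hY hd hone
  rw [one_smul] at hEE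
  refine ⟨Y₀, z₀, _, hK, hY, hz, hd, hEE, hh, exists_solvesTangentSystem hE hU hK hEE hh ?_⟩
  intro u hu
  have h1 := tendsto_nhds_unique (tendsto_mul_matInner_pinv hE hB hK hx hY hz hd hu)
    (hone.mul_const _)
  rw [h1, one_mul]

theorem SolvesTangentSystem.fst_unique {Y₀ : Matrix (Fin m) (Fin m) ℝ}
    {z₀ : EuclideanSpace ℝ (Fin s)} {d d' : EuclideanSpace ℝ (Fin n)}
    {W W' : Matrix (Fin m) (Fin m) ℝ}
    (hE : IsOrthonormalBasisMatrix E (matrixNullSpace (P.G xstar)))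
    (hU : IsOrthonormalBasisMatrix U (P.subspaceU E xstar))
    (hSSOSC : P.SSOSC E xstar) (hK : P.IsKKT xstar Y₀ z₀) (hpos : (Eᵀ * Y₀ * E).PosDef)
    (h : P.SolvesTangentSystem U xstar Y₀ z₀ d W)
    (h' : P.SolvesTangentSystem U xstar Y₀ z₀ d' W') : d = d' := by
  refine sub_eq_zero.mp (eq_zero_of_homogeneous_tangentSystem (W := W - W') hE hU hSSOSC hK hpos
    (h.symm.sub h'.symm) ?_ ?_ ?_)
  · rw [adjG_sub, WithLp.ofLp_sub, Matrix.mulVec_sub (P.hessL xstar Y₀ z₀), sub_sub_sub_comm,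
      Matrix.mulVec_sub, h.eq_L, h'.eq_L, sub_zero]
  · have h1 := congrArg₂ (· - ·) h.eq_G h'.eq_G
    simp only [sub_self] at h1
    rw [← h1, deltaG_sub]
    simp only [symMul, Matrix.mul_sub, Matrix.sub_mul]
    abel
  · rw [WithLp.ofLp_sub, Matrix.mulVec_sub, h.eq_h, h'.eq_h, sub_zero]

/-- The rescaled barrier points do not converge to zero. -/
theorem limit_ne_zero (l : Ultrafilter ι)
    (hE : IsOrthonormalBasisMatrix E (matrixNullSpace (P.G xstar))) (hSSOSC : P.SSOSC E xstar)
    (hB : ∀ k, P.IsBKKT (μ k) (x k) (Y k) (z k)) (hne : ∀ k, x k ≠ xstar)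
    {Y₀ : Matrix (Fin m) (Fin m) ℝ} {z₀ : EuclideanSpace ℝ (Fin s)}
    (hK : P.IsKKT xstar Y₀ z₀) (hx : Filter.Tendsto x l (𝓝 xstar))
    (hY : Filter.Tendsto Y l (𝓝 Y₀)) (hz : Filter.Tendsto z l (𝓝 z₀))
    {d : EuclideanSpace ℝ (Fin n)}
    (hd : Filter.Tendsto (fun k => (μ k)⁻¹ • (x k - xstar)) l (𝓝 d)) : d ≠ 0 := by
  rintro rfl
  have hμ0 := fun k => (hB k).mu_pos
  have hone : Filter.Tendsto (fun k => (μ k)⁻¹ * μ k) l (𝓝 1) := by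
    simp only [fun k => inv_mul_cancel₀ (hμ0 k).ne']
    exact tendsto_const_nhds
  have hEE := conj_deltaG_mul_conj_eq hE hB hK hx hY hd hone
  rw [one_smul, show P.deltaG xstar 0 = 0 by simp [deltaG], Matrix.mul_zero, Matrix.zero_mul,
    Matrix.zero_mul] at hEE
  -- The relation 0 = 1 among q × q matrices means q = 0: the null space of G(x*) is trivial and the
  -- semidefinite constraint is inactive.
  have hzero : ∀ M : Matrix (Fin q) (Fin q) ℝ, M = 0 := fun M => by
    rw [← Matrix.mul_one M, ← hEE, Matrix.mul_zero]
  have hcoef : ∀ u ∈ P.subspaceU E xstar,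
      matInner (P.deltaG xstar u) (pinv (P.G xstar)) = 0 := by
    intro u hu
    have h1 := tendsto_nhds_unique (tendsto_mul_matInner_pinv hE hB hK hx hY hz hd hu)
      (hone.mul_const _)
    rw [one_mul, WithLp.ofLp_zero, Matrix.mulVec_zero, dotProduct_zero] at h1
    exact h1.symm
  have hnorm : ∀ k, ‖‖x k - xstar‖⁻¹ • (x k - xstar)‖ = 1 := fun k =>
    norm_smul_inv_norm (𝕜 := ℝ) (sub_ne_zero.mpr (hne k))
  -- Rescaling by the distance instead of μ gives a unit limit direction. The ratio μ/‖x - x*‖ may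
  -- be unbounded, but its coefficient is exactly zero by `hcoef`.
  obtain ⟨e, he⟩ := l.exists_tendsto_of_norm_le_one
    (w := fun k => ‖x k - xstar‖⁻¹ • (x k - xstar)) fun k => (hnorm k).le
  have he1 : ‖e‖ = 1 := by
    have := he.norm
    simp only [hnorm] at this
    exact tendsto_nhds_unique this tendsto_const_nhds
  have hu : e ∈ P.subspaceU E xstar :=
    ⟨hzero _, P.gradH_transpose_mulVec_eq_zero hx he (fun k => (hB k).h_eq_zero) hK.h_eq_zero⟩
  have h2 := tendsto_mul_matInner_pinv hE hB hK hx hY hz he hu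
  simp only [hcoef e hu, mul_zero] at h2
  have h3 := tendsto_nhds_unique h2 tendsto_const_nhds
  refine (hSSOSC Y₀ z₀ hK e (hK.mem_criticalCone hE hu) ?_).ne' h3
  rintro rfl
  simp at he1

end NSDP

/-! ### Normalized directions and the main theorem -/

theorem Filter.Tendsto.inv_norm_smul {ι X : Type*} [NormedAddCommGroup X] [NormedSpace ℝ X]
    {l : Filter ι} {v : ι → X} {c : ι → ℝ} {w : X} (hc : ∀ k, 0 < c k) (hw : w ≠ 0)
    (h : Filter.Tendsto (fun k => c k • v k) l (𝓝 w)) :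
    Filter.Tendsto (fun k => ‖v k‖⁻¹ • v k) l (𝓝 (‖w‖⁻¹ • w)) := by
  refine ((h.norm.inv₀ (norm_ne_zero_iff.mpr hw)).smul h).congr fun k => ?_
  rw [norm_smul, Real.norm_eq_abs, abs_of_pos (hc k), smul_smul, mul_inv_rev, mul_assoc,
    inv_mul_cancel₀ (hc k).ne', mul_one]

theorem corollary3p1 {n m s q p : ℕ} (P : NSDP n m s)
    (xstar : EuclideanSpace ℝ (Fin n))
    -- the columns of `E` form an arbitrary orthonormal basis of the null space of `G(x*)`
    (E : Matrix (Fin m) (Fin q) ℝ)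
    (hE : IsOrthonormalBasisMatrix E (matrixNullSpace (P.G xstar)))
    -- the columns of `U` form an arbitrary orthonormal basis of the subspace `𝒰`
    (U : Matrix (Fin n) (Fin p) ℝ)
    (hU : IsOrthonormalBasisMatrix U (P.subspaceU E xstar))
    -- `x*` is a KKT point satisfying the standing assumptions
    (hSC : P.StrictComplementarity xstar)
    (hSSOSC : P.SSOSC E xstar)
    (hMFCQ : P.MFCQ xstar)
    -- a sequence of BKKT triplets with `μ_k → 0` and `x^k → x*`, `x^k ≠ x*`
    (μ : ℕ → ℝ) (x : ℕ → EuclideanSpace ℝ (Fin n)) (Y : ℕ → Matrix (Fin m) (Fin m) ℝ)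
    (z : ℕ → EuclideanSpace ℝ (Fin s))
    (hBKKT : ∀ k, P.IsBKKT (μ k) (x k) (Y k) (z k))
    (hμ : Filter.Tendsto μ Filter.atTop (𝓝 0))
    (hx : Filter.Tendsto x Filter.atTop (𝓝 xstar))
    (hne : ∀ k, x k ≠ xstar) :
    ∃ (Ya : Matrix (Fin m) (Fin m) ℝ) (za : EuclideanSpace ℝ (Fin s))
      (ξ : EuclideanSpace ℝ (Fin n)),
      -- `(Ya, za)` is the unique analytic center at `x*`
      P.IsAnalyticCenter E xstar Ya za ∧
      (∀ Y' z', P.IsAnalyticCenter E xstar Y' z' → Y' = Ya ∧ z' = za) ∧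
      -- `ξ` is the unique `Δx`-component of the solutions of the linear system at `(x*, Ya, za)`
      (∃ ΔY, P.SolvesTangentSystem U xstar Ya za ξ ΔY) ∧
      (∀ Δx ΔY, P.SolvesTangentSystem U xstar Ya za Δx ΔY → Δx = ξ) ∧
      ξ ≠ 0 ∧
      -- the normalized directions converge
      Filter.Tendsto (fun k => ‖x k - xstar‖⁻¹ • (x k - xstar)) Filter.atTop
        (𝓝 (‖ξ‖⁻¹ • ξ)) ∧
      Filter.Tendsto (fun k => ‖xstar - x k‖⁻¹ • (xstar - x k)) Filter.atTop
        (𝓝 (-(‖ξ‖⁻¹ • ξ))) := by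
  have hμ0 := fun k => (hBKKT k).mu_pos
  -- One arbitrary ultrafilter supplies the candidates; uniqueness later shows that the choice is
  -- immaterial.
  obtain ⟨Ya, za, ξ, hK, hY, hz, hξ, hEE, hh, hsol⟩ := NSDP.exists_tendsto_of_isBKKT
    (Ultrafilter.of Filter.atTop) hE hU hSC hSSOSC hMFCQ hBKKT
    (hμ.mono_left (Ultrafilter.of_le _)) (hx.mono_left (Ultrafilter.of_le _))
  have hne0 : ξ ≠ 0 := NSDP.limit_ne_zero (Ultrafilter.of Filter.atTop) hE hSSOSC hBKKT hne hK
    (hx.mono_left (Ultrafilter.of_le _)) hY hz hξ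
  have hcenter := fun Y' z' (hA : P.IsAnalyticCenter E xstar Y' z') => hA.eq hE hMFCQ hK hEE hh
  have hpos : (Eᵀ * Ya * E).PosDef :=
    (hK.Y_posSemidef.transpose_mul_mul_same E).posDef_iff_isUnit.mpr (.of_mul_eq_one_right _ hEE)
  have huniq : ∀ Δx ΔY, P.SolvesTangentSystem U xstar Ya za Δx ΔY → Δx = ξ := fun Δx ΔY h =>
    h.fst_unique hE hU hSSOSC hK hpos hsol.choose_spec
  have hlim : Filter.Tendsto (fun k => (μ k)⁻¹ • (x k - xstar)) Filter.atTop (𝓝 ξ) := by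
    -- Along any other ultrafilter the limit multiplier is again an analytic center, hence the same
    -- pair; the limit direction then solves the same linear system and equals ξ.
    refine (Filter.tendsto_iff_ultrafilter _ _ _).2 fun l hl => ?_
    obtain ⟨Y', z', ξ', hK', -, -, hξ', hEE', hh', ΔY, hsol'⟩ := NSDP.exists_tendsto_of_isBKKT
      l hE hU hSC hSSOSC hMFCQ hBKKT (hμ.mono_left hl) (hx.mono_left hl)
    obtain ⟨rfl, rfl⟩ := hcenter Y' z' (hK'.isAnalyticCenter hE hMFCQ hEE' hh')
    rwa [← huniq ξ' ΔY hsol']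
  have hdir := hlim.inv_norm_smul (fun k => inv_pos.mpr (hμ0 k)) hne0
  refine ⟨Ya, za, ξ, hK.isAnalyticCenter hE hMFCQ hEE hh, hcenter, hsol, huniq, hne0, hdir, ?_⟩
  refine hdir.neg.congr fun k => ?_
  rw [← smul_neg, neg_sub, norm_sub_rev]
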